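/- Let $d\ge 1$ and write $(\Delta_h f)(y)=f(y+h)-f(y)$, $\Delta_h^m=(\Delta_h)^m$. For $s>0$ and $p\in[1,\infty]$ put \[ \|f\|_{B^s_{p,\infty}}=\|f\|_{L^p(\mathbb R^d)}+\sup_{0<|h|<1}|h|^{-s}\|\Delta_h^{\lfloor s\rfloor+1}f\|_{L^p(\mathbb R^d)}, \] let $B^s_{p,\infty}$ be the closure of the Schwartz space in this norm, and let $\mathscr C^\alpha_b=B^\alpha_{\infty,\infty}$ (its elements being identified with their continuous representatives). Let $a_0>0$, $\theta>0$, $a\in(0,a_0)$ and $\delta>0$. Then there is an integer $m_0$, depending only on $d,a_0,\theta,a,\delta$, such that for every integer $m\ge m_0$ there is a constant $c>0$, depending only on $d,a_0,\theta,a,\delta,m$, with the following property. Let $b\in L^\infty(\mathbb R^d;\mathbb R^d)$, let $\sigma:\mathbb R^d\to\mathbb R^{d\times d'}$ be bounded and Hölder continuous of some exponent $\beta\in(0,1)$, let $x\in\mathbb R^d$, and let $X$ be a solution, on some filtered probability space with a $d'$-dimensional Brownian motion $B$, of \[ dX_t=b(X_t)\,dt+\sigma(X_t)\,dB_t,\qquad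 X_0=x . \] Let $t>0$ and $K_0\ge 1$ be such that \[ \mathbb E[(\Delta_h^m\phi)(X_t)]\le K_0^{\frac{\alpha}{\theta}}\Bigl(\epsilon^{\frac{\alpha}{\theta}(1+a_0)}+\bigl(|h|/\epsilon^{1/\theta}\bigr)^m\Bigr)\|\phi\|_{\mathscr C^\alpha_b} \] for every $\epsilon$ with $0<\epsilon<1$ and $\epsilon\le t/2$, every $\alpha\in(0,1)$, every $\phi\in\mathscr C^\alpha_b$ and every $h\in\mathbb R^d$ with $|h|\le 1$. Then $X_t$ has a density $p_x(t)$ with respect to Lebesgue measure, $p_x(t)\in B^a_{1,\infty}$, and \[ \|p_x(t)\|_{B^a_{1,\infty}}\le c\,K_0^{\frac{a}{\theta a_0}+\delta}\,(1\wedge t)^{-\frac{1+a_0}{\theta a_0}a-\delta}. \] In particular $c$ does not depend on $x$, $t$, $K_0$ or the coefficients. -/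

import Mathlib

open MeasureTheory ProbabilityTheory
open scoped NNReal ENNReal SchwartzMap

noncomputable section

/-- Euclidean space `ℝ^d`. -/
abbrev Euc (d : ℕ) : Type := EuclideanSpace ℝ (Fin d)

/-! ### Besov spaces `B^s_{p,∞}(ℝ^d)` through differences -/

/-- The seminorm `[f]_{B^s_{p,∞}} = sup_{0 < |h| < 1} ‖Δ_h^n f‖_{L^p} / |h|^s`, computed with the
smallest integer `n > s`. (The supremum over `h` equals the essential supremum, because
`h ↦ ‖Δ_h^n f‖_{L^p}` is lower semicontinuous.) -/
def besovSeminorm {d : ℕ} (s : ℝ) (p : ℝ≥0∞) (f : Euc d → ℝ) : ℝ≥0∞ :=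
  ⨆ (h : Euc d) (_ : 0 < ‖h‖ ∧ ‖h‖ < 1),
    eLpNorm ((fwdDiff h)^[⌊s⌋₊ + 1] f) p volume / ENNReal.ofReal (‖h‖ ^ s)

/-- The norm `‖f‖_{B^s_{p,∞}} = ‖f‖_{L^p} + [f]_{B^s_{p,∞}}`, for `s > 0`. -/
def besovNorm {d : ℕ} (s : ℝ) (p : ℝ≥0∞) (f : Euc d → ℝ) : ℝ≥0∞ :=
  eLpNorm f p volume + besovSeminorm s p f

/-- Membership in the (separable) space `B^s_{p,∞}(ℝ^d)`: the closure of the Schwartz space with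
respect to the norm `‖·‖_{B^s_{p,∞}}`. -/
def MemBesov {d : ℕ} (s : ℝ) (p : ℝ≥0∞) (f : Euc d → ℝ) : Prop :=
  ∀ η : ℝ≥0∞, 0 < η → ∃ g : 𝓢(Euc d, ℝ), besovNorm s p (fun y => f y - g y) < η

/-- The Zygmund space `𝒞^α_b(ℝ^d) = B^α_{∞,∞}(ℝ^d)`; its elements are identified with their
continuous representatives. For `α ∈ (0,1)` the norm `besovNorm α ⊤` is the Hölder norm
`sup |φ| + sup_{0 < |h| < 1, y} |φ (y + h) - φ y| / |h|^α`. -/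
def MemZygmund {d : ℕ} (α : ℝ) (φ : Euc d → ℝ) : Prop :=
  Continuous φ ∧ MemBesov α ⊤ φ

/-! ### The stochastic differential equation -/

/-- `σ ∈ C^β_b(ℝ^d; ℝ^{d×d'})`: bounded and Hölder continuous of exponent `β`. -/
def IsBoundedHolder {d d' : ℕ} (β : ℝ) (σ : Euc d → Matrix (Fin d) (Fin d') ℝ) : Prop :=
  ∃ C : ℝ, (∀ y i j, |σ y i j| ≤ C) ∧ ∀ y z i j, |σ y i j - σ z i j| ≤ C * ‖y - z‖ ^ β

/-- `B` is a standard `k`-dimensional Brownian motion with respect to the filtration `ℱ`. -/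
structure IsBrownianMotion {Ω : Type*} {mΩ : MeasurableSpace Ω} {k : ℕ}
    (ℱ : Filtration ℝ≥0 mΩ) (P : Measure Ω) (B : ℝ≥0 → Ω → Euc k) : Prop where
  adapted : ∀ t, Measurable[ℱ t] (B t)
  zero : ∀ᵐ ω ∂P, B 0 ω = 0
  continuous : ∀ᵐ ω ∂P, Continuous fun t => B t ω
  indep : ∀ s t, s ≤ t →
    Indep (MeasurableSpace.comap (fun ω => B t ω - B s ω) inferInstance) (ℱ s) P
  law : ∀ s t, s ≤ t →
    P.map (fun ω => B t ω - B s ω) =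
      (stdGaussian (Euc k)).map (fun z => Real.sqrt ((t : ℝ) - s) • z)

/-- A simple matrix-valued integrand `∑_{k<n} ξ_k 1_{(t_k, t_{k+1}]}`, with `ξ_k` bounded and
`ℱ_{t_k}`-measurable. -/
structure SimpleIntegrand {Ω : Type*} {mΩ : MeasurableSpace Ω} (ℱ : Filtration ℝ≥0 mΩ)
    (d d' : ℕ) where
  n : ℕ
  time : ℕ → ℝ≥0
  mono : Monotone time
  val : ℕ → Ω → Matrix (Fin d) (Fin d') ℝ
  measurable : ∀ k i j, Measurable[ℱ (time k)] fun ω => val k ω i j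
  bounded : ∃ C : ℝ, ∀ k ω i j, |val k ω i j| ≤ C

namespace SimpleIntegrand

variable {Ω : Type*} {mΩ : MeasurableSpace Ω} {ℱ : Filtration ℝ≥0 mΩ} {d d' : ℕ}

/-- The value at time `s` of a simple integrand. -/
def process (S : SimpleIntegrand ℱ d d') (s : ℝ≥0) (ω : Ω) : Matrix (Fin d) (Fin d') ℝ :=
  ∑ k ∈ Finset.range S.n, if S.time k < s ∧ s ≤ S.time (k + 1) then S.val k ω else 0

/-- The stochastic integral `∑_k ξ_k (B_{t_{k+1} ∧ t} - B_{t_k ∧ t})` of a simple integrand. -/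
def integral (S : SimpleIntegrand ℱ d d') (B : ℝ≥0 → Ω → Euc d') (t : ℝ≥0) (ω : Ω) : Euc d :=
  ∑ k ∈ Finset.range S.n,
    Matrix.toLpLin 2 2 (S.val k ω) (B (min (S.time (k + 1)) t) ω - B (min (S.time k) t) ω)

end SimpleIntegrand

/-- `J` is the Itô integral `∫_0^t H_s dB_s`: there are simple integrands `S_n` with
`E ∫_0^t |S_n(s) - H_s|² ds → 0` (Hilbert–Schmidt norm) and `E |∫_0^t S_n dB - J|² → 0`. -/
def IsItoIntegral {Ω : Type*} {mΩ : MeasurableSpace Ω} {d d' : ℕ} (ℱ : Filtration ℝ≥0 mΩ)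
    (P : Measure Ω) (B : ℝ≥0 → Ω → Euc d') (H : ℝ≥0 → Ω → Matrix (Fin d) (Fin d') ℝ)
    (t : ℝ≥0) (J : Ω → Euc d) : Prop :=
  ∃ S : ℕ → SimpleIntegrand ℱ d d',
    Filter.Tendsto (fun n => ∫⁻ ω, (∫⁻ s in Set.Icc (0 : ℝ) t,
        ENNReal.ofReal
          (∑ i, ∑ j, ((S n).process s.toNNReal ω i j - H s.toNNReal ω i j) ^ 2)) ∂P)
      Filter.atTop (nhds 0) ∧
    Filter.Tendsto (fun n => eLpNorm (fun ω => (S n).integral B t ω - J ω) 2 P)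
      Filter.atTop (nhds 0)

/-- `X` is a solution, driven by the `ℱ`-Brownian motion `B`, of
`dX_t = b(X_t) dt + σ(X_t) dB_t`, `X_0 = x`. -/
structure IsSDESolution {Ω : Type*} {mΩ : MeasurableSpace Ω} {d d' : ℕ}
    (b : Euc d → Euc d) (σ : Euc d → Matrix (Fin d) (Fin d') ℝ) (x : Euc d)
    (ℱ : Filtration ℝ≥0 mΩ) (P : Measure Ω) (B : ℝ≥0 → Ω → Euc d') (X : ℝ≥0 → Ω → Euc d) :
    Prop where
  brownian : IsBrownianMotion ℱ P B
  adapted : ∀ t, Measurable[ℱ t] (X t)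
  continuous : ∀ᵐ ω ∂P, Continuous fun t => X t ω
  initial : ∀ᵐ ω ∂P, X 0 ω = x
  drift_integrable : ∀ᵐ ω ∂P, ∀ t : ℝ≥0,
    IntervalIntegrable (fun s : ℝ => b (X s.toNNReal ω)) volume 0 t
  equation : ∀ t : ℝ≥0, ∃ J : Ω → Euc d,
    IsItoIntegral ℱ P B (fun s ω => σ (X s ω)) t J ∧
    ∀ᵐ ω ∂P, X t ω = x + (∫ s in (0 : ℝ)..t, b (X s.toNNReal ω)) + J ω

end

/-!
Write `μ` for the law of `X_t` and `Ψ` for a combination of dilates of a bump function chosen so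
that averaging against `Ψ_ε` differs from the identity by averages of `Δ_{εu}^m`. At the scale
`ε ∼ |h|^{γθ}` the first term of the hypothesis dominates as soon as `m (1 - γ) ≥ s`, where
`s = γ α (1 + a₀)`, so that the `μ`-integral of `Δ_h^m g` is `O(|h|^s)` for `α`-Hölder test
functions `g`. If `α > a / a₀`, then `s > α + a` for `γ < 1` close to `1`; taking `α` close to
`a / a₀` gives the exponents of `K₀` and `1 ∧ t`.

By duality such a bound controls the `L¹` norms of the differences of the increments
`Ψ_{ε/2} ⋆ (Ψ_{ε/4} - Ψ_ε) ⋆ μ` of the mollifications `Ψ_{ε/2} ⋆ Ψ_ε ⋆ μ`: on the side of the test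
function, `Ψ_{ε/2}` supplies both Hölder regularity, at the price of `ε^{-α}`, and the factor
`|h|^a ε^{-a}`, whereas `Ψ_{ε/4} - Ψ_ε`, a difference of two near-identities, supplies `ε^s`. The
resulting bound `|h|^a ε^{s-α-a}` is summable over `ε = 2⁻ʲ`, and the mollifications converge in
`B^a_{1,∞}` to the density of `μ`.
-/

noncomputable section

open Function Set Filter
open scoped Topology Convolution

/-! ### Forward differences -/

section FwdDiff

lemma fwdDiff_iter_sub {M G : Type*} [AddCommMonoid M] [AddCommGroup G] (h : M) (f g : M → G)
    (n : ℕ) : (fwdDiff h)^[n] (f - g) = (fwdDiff h)^[n] f - (fwdDiff h)^[n] g := by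
  simpa only [fwdDiff_aux.coe_fwdDiffₗ_pow] using map_sub (fwdDiff_aux.fwdDiffₗ M G h ^ n) f g

lemma norm_fwdDiff_iter_le {M F : Type*} [AddCommMonoid M] [SeminormedAddCommGroup F] {f : M → F}
    {C : ℝ} (hf : ∀ x, ‖f x‖ ≤ C) (h : M) (n : ℕ) (x : M) : ‖(fwdDiff h)^[n] f x‖ ≤ 2 ^ n * C := by
  induction n generalizing x with
  | zero => simpa using hf x
  | succ n ih =>
    rw [iterate_succ_apply', pow_succ']
    exact (norm_sub_le_of_le (ih _) (ih _)).trans_eq (by ring)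

lemma continuous_fwdDiff_iter {M G : Type*} [AddCommMonoid M] [AddCommGroup G] [TopologicalSpace M]
    [ContinuousAdd M] [TopologicalSpace G] [IsTopologicalAddGroup G] {f : M → G}
    (hf : Continuous f) (h : M) (n : ℕ) : Continuous ((fwdDiff h)^[n] f) := by
  induction n with
  | zero => exact hf
  | succ n ih => rw [iterate_succ_apply']; exact (ih.comp (continuous_add_const h)).sub ih

variable {M F : Type*} [AddCommGroup M] [MeasurableSpace M] [MeasurableAdd M]
  [NormedAddCommGroup F] {ν : Measure M} [ν.IsAddRightInvariant] {f g : M → F}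

lemma ae_eq_fwdDiff_iter (hfg : f =ᵐ[ν] g) (h : M) (n : ℕ) :
    (fwdDiff h)^[n] f =ᵐ[ν] (fwdDiff h)^[n] g := by
  induction n with
  | zero => exact hfg
  | succ n ih =>
    rw [iterate_succ_apply', iterate_succ_apply']
    exact ((measurePreserving_add_right ν h).quasiMeasurePreserving.ae_eq_comp ih).sub ih

lemma aestronglyMeasurable_fwdDiff_iter (hf : AEStronglyMeasurable f ν) (h : M) (n : ℕ) :
    AEStronglyMeasurable ((fwdDiff h)^[n] f) ν := by
  induction n with
  | zero => exact hf
  | succ n ih =>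
    rw [iterate_succ_apply']
    exact (ih.comp_quasiMeasurePreserving
      (measurePreserving_add_right ν h).quasiMeasurePreserving).sub ih

lemma integrable_fwdDiff (hf : Integrable f ν) (h : M) : Integrable (fwdDiff h f) ν :=
  (hf.comp_add_right h).sub hf

lemma integrable_fwdDiff_iter (hf : Integrable f ν) (h : M) (n : ℕ) :
    Integrable ((fwdDiff h)^[n] f) ν := by
  induction n with
  | zero => exact hf
  | succ n ih => rw [iterate_succ_apply']; exact integrable_fwdDiff ih h

lemma integral_norm_fwdDiff_le (hf : Integrable f ν) (h : M) :
    ∫ x, ‖fwdDiff h f x‖ ∂ν ≤ 2 * ∫ x, ‖f x‖ ∂ν := by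
  have hfh : Integrable (fun x => f (x + h)) ν := hf.comp_add_right h
  calc ∫ x, ‖fwdDiff h f x‖ ∂ν ≤ ∫ x, (‖f (x + h)‖ + ‖f x‖) ∂ν :=
        integral_mono (integrable_fwdDiff hf h).norm (hfh.norm.add hf.norm) fun x => norm_sub_le _ _
    _ = 2 * ∫ x, ‖f x‖ ∂ν := by
        rw [integral_add hfh.norm hf.norm, integral_add_right_eq_self (fun x => ‖f x‖) h, two_mul]

lemma integral_norm_fwdDiff_iter_le (hf : Integrable f ν) (h : M) (n : ℕ) :
    ∫ x, ‖(fwdDiff h)^[n] f x‖ ∂ν ≤ 2 ^ n * ∫ x, ‖f x‖ ∂ν := by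
  induction n with
  | zero => simp
  | succ n ih =>
    rw [iterate_succ_apply']
    calc ∫ x, ‖fwdDiff h ((fwdDiff h)^[n] f) x‖ ∂ν ≤ 2 * ∫ x, ‖(fwdDiff h)^[n] f x‖ ∂ν :=
          integral_norm_fwdDiff_le (integrable_fwdDiff_iter hf h n) h
      _ ≤ 2 * (2 ^ n * ∫ x, ‖f x‖ ∂ν) := by gcongr
      _ = 2 ^ (n + 1) * ∫ x, ‖f x‖ ∂ν := by ring

end FwdDiff

/-! ### Test functions -/

open scoped ContDiff in
/-- Smooth functions with compact support. -/
structure IsTestFun {E F : Type*} [NormedAddCommGroup E] [NormedSpace ℝ E] [NormedAddCommGroup F]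
    [NormedSpace ℝ F] (κ : E → F) : Prop where
  smooth : ContDiff ℝ ∞ κ
  compact : HasCompactSupport κ

namespace IsTestFun

variable {E F : Type*} [NormedAddCommGroup E] [NormedSpace ℝ E] [NormedAddCommGroup F]
  [NormedSpace ℝ F] {κ κ' : E → F}

protected lemma continuous (hκ : IsTestFun κ) : Continuous κ := hκ.smooth.continuous

protected lemma differentiable (hκ : IsTestFun κ) : Differentiable ℝ κ :=
  hκ.smooth.differentiable (by simp)

protected lemma add (hκ : IsTestFun κ) (hκ' : IsTestFun κ') : IsTestFun (κ + κ') :=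
  ⟨hκ.smooth.add hκ'.smooth, hκ.compact.add hκ'.compact⟩

protected lemma sub (hκ : IsTestFun κ) (hκ' : IsTestFun κ') : IsTestFun (κ - κ') :=
  ⟨hκ.smooth.sub hκ'.smooth, hκ.compact.sub hκ'.compact⟩

protected lemma const_smul (hκ : IsTestFun κ) (c : ℝ) : IsTestFun (c • κ) :=
  ⟨hκ.smooth.const_smul c, hκ.compact.comp_left (g := fun x => c • x) (smul_zero c)⟩

protected lemma sum {ι : Type*} {s : Finset ι} {κ : ι → E → F} (h : ∀ i ∈ s, IsTestFun (κ i)) :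
    IsTestFun (∑ i ∈ s, κ i) :=
  Finset.sum_induction κ IsTestFun (fun _ _ => IsTestFun.add)
    ⟨contDiff_const, HasCompactSupport.zero⟩ h

protected lemma comp_add_right (hκ : IsTestFun κ) (h : E) : IsTestFun fun x => κ (x + h) :=
  ⟨hκ.smooth.comp (contDiff_id.add contDiff_const),
    hκ.compact.comp_homeomorph (Homeomorph.addRight h)⟩

protected lemma comp_smul (hκ : IsTestFun κ) {r : ℝ} (hr : r ≠ 0) : IsTestFun fun x => κ (r • x) :=
  ⟨hκ.smooth.comp (contDiff_const_smul r),
    hκ.compact.comp_homeomorph (Homeomorph.smulOfNeZero r hr)⟩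

protected lemma comp_neg (hκ : IsTestFun κ) : IsTestFun fun x => κ (-x) := by
  simpa only [neg_one_smul] using hκ.comp_smul (r := -1) (by norm_num)

protected lemma fwdDiff (hκ : IsTestFun κ) (h : E) : IsTestFun (fwdDiff h κ) :=
  (hκ.comp_add_right h).sub hκ

protected lemma fwdDiff_iter (hκ : IsTestFun κ) (h : E) (n : ℕ) :
    IsTestFun ((fwdDiff h)^[n] κ) := by
  induction n with
  | zero => exact hκ
  | succ n ih => rw [iterate_succ_apply']; exact ih.fwdDiff h

protected lemma fderiv (hκ : IsTestFun κ) : IsTestFun (fderiv ℝ κ) :=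
  ⟨hκ.smooth.fderiv_right (by simp), hκ.compact.fderiv ℝ⟩

protected lemma iteratedFDeriv (hκ : IsTestFun κ) (j : ℕ) : IsTestFun (iteratedFDeriv ℝ j κ) :=
  ⟨hκ.smooth.iteratedFDeriv_right (by exact_mod_cast le_top), hκ.compact.iteratedFDeriv j⟩

lemma iteratedFDeriv_fwdDiff (hκ : IsTestFun κ) (h : E) (j : ℕ) :
    iteratedFDeriv ℝ j (fwdDiff h κ) = fwdDiff h (iteratedFDeriv ℝ j κ) := by
  have hsub : fwdDiff h κ = (fun x => κ (x + h)) - κ := rfl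
  rw [hsub, iteratedFDeriv_sub
    ((hκ.comp_add_right h).smooth.of_le (by exact_mod_cast le_top))
    (hκ.smooth.of_le (by exact_mod_cast le_top))]
  ext1 x
  simp only [Pi.sub_apply, iteratedFDeriv_comp_add_right, fwdDiff]

lemma enorm_fwdDiff_le_lintegral [CompleteSpace F] (hκ : IsTestFun κ) (h x : E) :
    ‖fwdDiff h κ x‖ₑ ≤ ∫⁻ t in Ioc (0 : ℝ) 1, ‖h‖ₑ * ‖fderiv ℝ κ (x + t • h)‖ₑ := by
  have hderiv (t : ℝ) : HasDerivAt (fun t : ℝ => κ (x + t • h)) (fderiv ℝ κ (x + t • h) h) t := by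
    have hline : HasDerivAt (fun t : ℝ => x + t • h) h t := by
      simpa using ((hasDerivAt_id t).smul_const h).const_add x
    exact (hκ.differentiable _).hasFDerivAt.comp_hasDerivAt t hline
  have hcont : Continuous fun t : ℝ => fderiv ℝ κ (x + t • h) h :=
    (hκ.fderiv.continuous.comp (by fun_prop)).clm_apply continuous_const
  have hint : fwdDiff h κ x = ∫ t in Ioc (0 : ℝ) 1, fderiv ℝ κ (x + t • h) h := by
    rw [← intervalIntegral.integral_of_le zero_le_one,
      intervalIntegral.integral_eq_sub_of_hasDerivAt (fun t _ => hderiv t)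
        (hcont.intervalIntegrable _ _)]
    simp [fwdDiff]
  rw [hint]
  refine (enorm_integral_le_lintegral_enorm _).trans (lintegral_mono fun t => ?_)
  rw [mul_comm]
  exact ContinuousLinearMap.le_opENorm _ _

section Integral

variable [MeasurableSpace E] [BorelSpace E] {ν : Measure E}

protected lemma integrable [IsFiniteMeasureOnCompacts ν] (hκ : IsTestFun κ) : Integrable κ ν :=
  hκ.continuous.integrable_of_hasCompactSupport hκ.compact

variable [CompleteSpace F] [SFinite ν] [ν.IsAddRightInvariant]

lemma lintegral_enorm_fwdDiff_le (hκ : IsTestFun κ) (h : E) :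
    ∫⁻ x, ‖fwdDiff h κ x‖ₑ ∂ν ≤ ‖h‖ₑ * ∫⁻ x, ‖fderiv ℝ κ x‖ₑ ∂ν := by
  have hmeas : Measurable (uncurry fun (x : E) (t : ℝ) => ‖h‖ₑ * ‖fderiv ℝ κ (x + t • h)‖ₑ) :=
    (continuous_enorm.comp (hκ.fderiv.continuous.comp (by fun_prop))).measurable.const_mul _
  calc ∫⁻ x, ‖fwdDiff h κ x‖ₑ ∂ν
      ≤ ∫⁻ x, ∫⁻ t in Ioc (0 : ℝ) 1, ‖h‖ₑ * ‖fderiv ℝ κ (x + t • h)‖ₑ ∂volume ∂ν :=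
        lintegral_mono (hκ.enorm_fwdDiff_le_lintegral h)
    _ = ∫⁻ t in Ioc (0 : ℝ) 1, ∫⁻ x, ‖h‖ₑ * ‖fderiv ℝ κ (x + t • h)‖ₑ ∂ν :=
        lintegral_lintegral_swap hmeas.aemeasurable
    _ = ∫⁻ _ in Ioc (0 : ℝ) 1, ‖h‖ₑ * ∫⁻ x, ‖fderiv ℝ κ x‖ₑ ∂ν := by
        congr 1 with t
        rw [lintegral_add_right_eq_self (fun x => ‖h‖ₑ * ‖fderiv ℝ κ x‖ₑ) (t • h),
          lintegral_const_mul _ hκ.fderiv.continuous.enorm.measurable]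
    _ = ‖h‖ₑ * ∫⁻ x, ‖fderiv ℝ κ x‖ₑ ∂ν := by simp

variable [IsFiniteMeasureOnCompacts ν]

lemma integral_norm_fwdDiff_le_norm_mul (hκ : IsTestFun κ) (h : E) :
    ∫ x, ‖fwdDiff h κ x‖ ∂ν ≤ ‖h‖ * ∫ x, ‖fderiv ℝ κ x‖ ∂ν := by
  rw [← ENNReal.ofReal_le_ofReal_iff (by positivity), ENNReal.ofReal_mul (norm_nonneg _),
    ofReal_integral_norm_eq_lintegral_enorm (hκ.fwdDiff h).integrable,
    ofReal_integral_norm_eq_lintegral_enorm hκ.fderiv.integrable, ofReal_norm]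
  exact hκ.lintegral_enorm_fwdDiff_le h

lemma integral_norm_iteratedFDeriv_fwdDiff_le (hκ : IsTestFun κ)
    (j : ℕ) (h : E) :
    ∫ x, ‖iteratedFDeriv ℝ j (fwdDiff h κ) x‖ ∂ν ≤ min 1 ‖h‖ *
      (2 * ∫ x, ‖iteratedFDeriv ℝ j κ x‖ ∂ν + ∫ x, ‖iteratedFDeriv ℝ (j + 1) κ x‖ ∂ν) := by
  have hD := hκ.iteratedFDeriv j
  have hj : 0 ≤ ∫ x, ‖iteratedFDeriv ℝ j κ x‖ ∂ν := by positivity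
  have hj' : 0 ≤ ∫ x, ‖iteratedFDeriv ℝ (j + 1) κ x‖ ∂ν := by positivity
  rw [hκ.iteratedFDeriv_fwdDiff]
  rcases le_total 1 ‖h‖ with hh | hh
  · rw [min_eq_left hh, one_mul]
    linarith [integral_norm_fwdDiff_le hD.integrable (ν := ν) h]
  · rw [min_eq_right hh]
    refine (hD.integral_norm_fwdDiff_le_norm_mul h).trans ?_
    simp only [norm_fderiv_iteratedFDeriv]
    gcongr
    linarith

lemma exists_integral_norm_iteratedFDeriv_fwdDiff_iter_le
    (hκ : IsTestFun κ) (n j : ℕ) :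
    ∃ C, 0 ≤ C ∧ ∀ h,
      ∫ x, ‖iteratedFDeriv ℝ j ((fwdDiff h)^[n] κ) x‖ ∂ν ≤ C * min 1 ‖h‖ ^ n := by
  induction n generalizing j with
  | zero => exact ⟨∫ x, ‖iteratedFDeriv ℝ j κ x‖ ∂ν, by positivity, fun h => by simp⟩
  | succ n ih =>
    obtain ⟨C, hC, hCn⟩ := ih j
    obtain ⟨C', hC', hCn'⟩ := ih (j + 1)
    refine ⟨2 * C + C', by positivity, fun h => ?_⟩
    rw [iterate_succ_apply']
    calc _ ≤ _ := (hκ.fwdDiff_iter h n).integral_norm_iteratedFDeriv_fwdDiff_le j h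
      _ ≤ min 1 ‖h‖ * (2 * (C * min 1 ‖h‖ ^ n) + C' * min 1 ‖h‖ ^ n) := by
          gcongr
          exacts [hCn h, hCn' h]
      _ = (2 * C + C') * min 1 ‖h‖ ^ (n + 1) := by ring

lemma exists_integral_norm_fwdDiff_iter_le (hκ : IsTestFun κ)
    (n : ℕ) : ∃ C, 0 ≤ C ∧ ∀ h, ∫ x, ‖(fwdDiff h)^[n] κ x‖ ∂ν ≤ C * min 1 ‖h‖ ^ n := by
  simpa only [norm_iteratedFDeriv_zero] using
    hκ.exists_integral_norm_iteratedFDeriv_fwdDiff_iter_le (ν := ν) n 0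

lemma exists_integral_norm_fwdDiff_fwdDiff_iter_le
    (hκ : IsTestFun κ) (n : ℕ) : ∃ C, 0 ≤ C ∧ ∀ h k,
      ∫ x, ‖fwdDiff k ((fwdDiff h)^[n] κ) x‖ ∂ν ≤ C * min 1 ‖k‖ * min 1 ‖h‖ ^ n := by
  obtain ⟨C, hC, hCn⟩ := hκ.exists_integral_norm_iteratedFDeriv_fwdDiff_iter_le (ν := ν) n 0
  obtain ⟨C', hC', hCn'⟩ := hκ.exists_integral_norm_iteratedFDeriv_fwdDiff_iter_le (ν := ν) n 1
  refine ⟨2 * C + C', by positivity, fun h k => ?_⟩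
  have hk := (hκ.fwdDiff_iter h n).integral_norm_iteratedFDeriv_fwdDiff_le (ν := ν) 0 k
  simp only [norm_iteratedFDeriv_zero] at hk hCn
  calc _ ≤ _ := hk
    _ ≤ min 1 ‖k‖ * (2 * (C * min 1 ‖h‖ ^ n) + C' * min 1 ‖h‖ ^ n) := by
        gcongr
        exacts [hCn h, hCn' h]
    _ = (2 * C + C') * min 1 ‖k‖ * min 1 ‖h‖ ^ n := by ring

end Integral

end IsTestFun

lemma min_one_pow_le_rpow {x r : ℝ} {n : ℕ} (hx : 0 ≤ x) (hr : 0 ≤ r) (hrn : r ≤ n) :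
    min 1 x ^ n ≤ x ^ r := by
  rcases hx.eq_or_lt with rfl | hx
  · rcases hr.eq_or_lt with rfl | hr
    · simpa using pow_le_one₀ le_rfl zero_le_one
    · have hn : n ≠ 0 := by rintro rfl; norm_num at hrn; linarith
      simp [hn, hr.ne']
  · calc min 1 x ^ n = min 1 x ^ (n : ℝ) := (Real.rpow_natCast _ _).symm
      _ ≤ min 1 x ^ r :=
        Real.rpow_le_rpow_of_exponent_ge (lt_min one_pos hx) (min_le_left _ _) hrn
      _ ≤ x ^ r := by gcongr; exact min_le_right _ _

/-! ### Dilations -/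

section Dilate

variable {E : Type*} [NormedAddCommGroup E] [NormedSpace ℝ E] {κ κ₁ κ₂ : E → ℝ} {ε : ℝ}

/-- The kernel `ε^{-d} κ(· / ε)`, where `d` is the dimension of the space. -/
def dilate (ε : ℝ) (κ : E → ℝ) (x : E) : ℝ := (ε ^ Module.finrank ℝ E)⁻¹ * κ (ε⁻¹ • x)

lemma dilate_one (κ : E → ℝ) : dilate 1 κ = κ := by
  ext x
  simp [dilate]

lemma dilate_dilate (ε η : ℝ) (κ : E → ℝ) : dilate ε (dilate η κ) = dilate (ε * η) κ := by
  ext x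
  simp only [dilate, smul_smul, mul_pow, mul_inv, mul_assoc, mul_comm η⁻¹]

lemma dilate_sum_smul {ι : Type*} (s : Finset ι) (c : ι → ℝ) (κ : ι → E → ℝ) (ε : ℝ) :
    dilate ε (∑ i ∈ s, c i • κ i) = ∑ i ∈ s, c i • dilate ε (κ i) := by
  ext x
  simp only [dilate, Finset.sum_apply, Pi.smul_apply, smul_eq_mul, Finset.mul_sum, mul_left_comm]

lemma fwdDiff_dilate (ε : ℝ) (κ : E → ℝ) (h : E) :
    fwdDiff h (dilate ε κ) = dilate ε (fwdDiff (ε⁻¹ • h) κ) := by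
  ext x
  simp only [fwdDiff, dilate, smul_add, mul_sub]

lemma fwdDiff_iter_dilate (ε : ℝ) (κ : E → ℝ) (h : E) (n : ℕ) :
    (fwdDiff h)^[n] (dilate ε κ) = dilate ε ((fwdDiff (ε⁻¹ • h))^[n] κ) := by
  induction n with
  | zero => rfl
  | succ n ih => rw [iterate_succ_apply', iterate_succ_apply', ih, fwdDiff_dilate]

protected lemma IsTestFun.dilate (hκ : IsTestFun κ) (hε : ε ≠ 0) : IsTestFun (dilate ε κ) :=
  (hκ.comp_smul (inv_ne_zero hε)).const_smul _

variable [FiniteDimensional ℝ E] [MeasureSpace E] [BorelSpace E]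
  [(volume : Measure E).IsAddHaarMeasure]

lemma integral_dilate_mul (hε : 0 < ε) (κ φ : E → ℝ) :
    ∫ x, dilate ε κ x * φ x = ∫ x, κ x * φ (ε • x) := by
  have hscale := Measure.integral_comp_inv_smul_of_nonneg volume
    (fun x : E => κ x * φ (ε • x)) hε.le
  simp only [smul_inv_smul₀ hε.ne', smul_eq_mul] at hscale
  simp only [dilate, mul_assoc]
  rw [integral_const_mul, hscale, inv_mul_cancel_left₀ (by positivity)]

lemma integral_dilate (hε : 0 < ε) (κ : E → ℝ) : ∫ x, dilate ε κ x = ∫ x, κ x := by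
  simpa only [mul_one] using integral_dilate_mul hε κ fun _ => 1

lemma integral_norm_dilate (hε : 0 < ε) (κ : E → ℝ) : ∫ x, ‖dilate ε κ x‖ = ∫ x, ‖κ x‖ := by
  rw [← integral_dilate hε fun x => ‖κ x‖]
  simp only [dilate, norm_mul, norm_inv, norm_pow, Real.norm_of_nonneg hε.le]

lemma dilate_convolution (hε : 0 < ε) (κ₁ κ₂ : E → ℝ) :
    dilate ε (κ₁ ⋆ κ₂) = dilate ε κ₁ ⋆ dilate ε κ₂ := by
  ext x
  simp only [convolution_lsmul, smul_eq_mul]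
  rw [integral_dilate_mul hε κ₁ fun t => dilate ε κ₂ (x - t)]
  simp only [dilate, convolution_lsmul, smul_eq_mul, smul_sub, inv_smul_smul₀ hε.ne',
    ← integral_const_mul, mul_left_comm]

namespace IsTestFun

lemma exists_integral_norm_fwdDiff_iter_dilate_le (hκ : IsTestFun κ) {n : ℕ} {r : ℝ} (hr : 0 ≤ r)
    (hrn : r ≤ n) : ∃ C, 0 ≤ C ∧ ∀ ε, 0 < ε → ∀ h,
      ∫ x, ‖(fwdDiff h)^[n] (dilate ε κ) x‖ ≤ C * (‖h‖ / ε) ^ r := by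
  obtain ⟨C, hC, hCn⟩ := hκ.exists_integral_norm_fwdDiff_iter_le (ν := volume) n
  refine ⟨C, hC, fun ε hε h => ?_⟩
  rw [fwdDiff_iter_dilate, integral_norm_dilate hε]
  refine (hCn _).trans ?_
  rw [norm_smul, norm_inv, Real.norm_of_nonneg hε.le, ← div_eq_inv_mul]
  gcongr
  exact min_one_pow_le_rpow (by positivity) hr hrn

lemma exists_integral_norm_fwdDiff_fwdDiff_iter_dilate_le (hκ : IsTestFun κ) {n : ℕ} {r α : ℝ}
    (hr : 0 ≤ r) (hrn : r ≤ n) (hα : 0 ≤ α) (hα' : α ≤ 1) : ∃ C, 0 ≤ C ∧ ∀ ε, 0 < ε → ∀ h k,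
      ∫ x, ‖fwdDiff k ((fwdDiff h)^[n] (dilate ε κ)) x‖ ≤
        C * (‖k‖ / ε) ^ α * (‖h‖ / ε) ^ r := by
  obtain ⟨C, hC, hCn⟩ := hκ.exists_integral_norm_fwdDiff_fwdDiff_iter_le (ν := volume) n
  refine ⟨C, hC, fun ε hε h k => ?_⟩
  rw [fwdDiff_iter_dilate, fwdDiff_dilate, integral_norm_dilate hε]
  refine (hCn _ _).trans ?_
  rw [norm_smul, norm_smul, norm_inv, Real.norm_of_nonneg hε.le, ← div_eq_inv_mul, ← div_eq_inv_mul]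
  gcongr
  · simpa only [pow_one] using
      min_one_pow_le_rpow (n := 1) (div_nonneg (norm_nonneg k) hε.le) hα (by simpa using hα')
  · exact min_one_pow_le_rpow (by positivity) hr hrn

end IsTestFun

end Dilate

/-! ### Averages and mollifications -/

/-- The averaging operator `φ ↦ ∫ κ(u) φ(· + u) du`, adjoint to convolution with `κ`. -/
def kernelAvg {E : Type*} [Add E] [MeasureSpace E] (κ φ : E → ℝ) (y : E) : ℝ :=
  ∫ u, κ u * φ (y + u)

/-- The density `∫ κ(· - y) μ(dy)` of the convolution of `κ(x) dx` with the measure `μ`. -/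
def mollify {E : Type*} [Sub E] [MeasurableSpace E] (κ : E → ℝ) (μ : Measure E) (x : E) : ℝ :=
  ∫ y, κ (x - y) ∂μ

section KernelAvg

variable {E : Type*} [NormedAddCommGroup E] [MeasureSpace E] [BorelSpace E]

variable {κ κ' κ₁ κ₂ φ : E → ℝ} {M : ℝ}

lemma integrable_mul_comp_add_left (hκ : Integrable κ) (hφ : Measurable φ) (hM : ∀ x, |φ x| ≤ M)
    (y : E) : Integrable fun u => κ u * φ (y + u) :=
  hκ.mul_bdd (hφ.comp (measurable_const_add y)).aestronglyMeasurable (.of_forall fun _ => hM _)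

lemma abs_kernelAvg_le (hκ : Integrable κ) (hφ : Measurable φ) (hM : ∀ x, |φ x| ≤ M) (y : E) :
    |kernelAvg κ φ y| ≤ M * ∫ x, ‖κ x‖ := by
  rw [mul_comm, ← integral_mul_const]
  refine (norm_integral_le_integral_norm _).trans (integral_mono
    (integrable_mul_comp_add_left hκ hφ hM y).norm (hκ.norm.mul_const M) fun u => ?_)
  rw [norm_mul]
  exact mul_le_mul_of_nonneg_left (hM _) (norm_nonneg _)

lemma kernelAvg_sub_left (hκ : Integrable κ) (hκ' : Integrable κ') (hφ : Measurable φ)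
    (hM : ∀ x, |φ x| ≤ M) : kernelAvg (κ - κ') φ = kernelAvg κ φ - kernelAvg κ' φ := by
  ext y
  simp only [kernelAvg, Pi.sub_apply, sub_mul]
  exact integral_sub (integrable_mul_comp_add_left hκ hφ hM y)
    (integrable_mul_comp_add_left hκ' hφ hM y)

lemma kernelAvg_sum_smul {ι : Type*} {s : Finset ι} {c : ι → ℝ} {κ : ι → E → ℝ}
    (hκ : ∀ i ∈ s, Integrable (κ i)) (hφ : Measurable φ) (hM : ∀ x, |φ x| ≤ M) (y : E) :
    kernelAvg (∑ i ∈ s, c i • κ i) φ y = ∑ i ∈ s, c i * kernelAvg (κ i) φ y := by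
  simp only [kernelAvg, Finset.sum_apply, Finset.sum_mul, Pi.smul_apply, smul_eq_mul, mul_assoc,
    ← integral_const_mul]
  exact integral_finsetSum _ fun i hi =>
    (integrable_mul_comp_add_left (hκ i hi) hφ hM y).const_mul _

variable [(volume : Measure E).IsAddRightInvariant]

lemma kernelAvg_eq_integral_sub (κ φ : E → ℝ) (y : E) :
    kernelAvg κ φ y = ∫ x, κ (x - y) * φ x := by
  rw [kernelAvg, ← integral_add_right_eq_self (fun x => κ (x - y) * φ x) y]
  simp only [add_sub_cancel_right, add_comm y]

lemma fwdDiff_kernelAvg (hκ : Integrable κ) (hφ : Measurable φ) (hM : ∀ x, |φ x| ≤ M) (k : E) :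
    fwdDiff k (kernelAvg κ φ) = kernelAvg (fwdDiff (-k) κ) φ := by
  have hsplit : fwdDiff (-k) κ = (fun u => κ (u + -k)) - κ := rfl
  have hshift (y : E) : kernelAvg (fun u => κ (u + -k)) φ y = kernelAvg κ φ (y + k) := by
    rw [kernelAvg, kernelAvg, ← integral_sub_right_eq_self (fun u => κ u * φ (y + k + u)) k]
    simp [sub_eq_add_neg, add_assoc]
  ext y
  rw [hsplit, kernelAvg_sub_left (hκ.comp_add_right _) hκ hφ hM, Pi.sub_apply, hshift]
  rfl

variable [SecondCountableTopology E]

lemma kernelAvg_convolution [SFinite (volume : Measure E)] (h₁ : Integrable κ₁)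
    (h₂ : Integrable κ₂) (hφ : Measurable φ) (hM : ∀ x, |φ x| ≤ M) :
    kernelAvg (κ₁ ⋆ κ₂) φ = kernelAvg κ₁ (kernelAvg κ₂ φ) := by
  ext y
  have hint : Integrable (uncurry fun x t => κ₁ t * κ₂ (x - t) * φ (y + x))
      ((volume : Measure E).prod volume) :=
    (h₁.convolution_integrand (ContinuousLinearMap.lsmul ℝ ℝ) h₂).mul_bdd
      (hφ.comp ((measurable_const_add y).comp measurable_fst)).aestronglyMeasurable
      (.of_forall fun _ => hM _)
  calc kernelAvg (κ₁ ⋆ κ₂) φ y = ∫ x, ∫ t, κ₁ t * κ₂ (x - t) * φ (y + x) := by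
        simp only [kernelAvg, integral_mul_const, convolution_lsmul, smul_eq_mul]
    _ = ∫ t, ∫ x, κ₁ t * κ₂ (x - t) * φ (y + x) := integral_integral_swap hint
    _ = ∫ t, κ₁ t * kernelAvg κ₂ φ (y + t) := by
        congr 1 with t
        simp only [mul_assoc, integral_const_mul]
        rw [kernelAvg, ← integral_sub_right_eq_self (fun u => κ₂ u * φ (y + t + u)) t]
        simp

end KernelAvg

section Mollify

variable {E : Type*} [NormedAddCommGroup E] [MeasureSpace E] [BorelSpace E]
  [SecondCountableTopology E] [(volume : Measure E).IsAddRightInvariant]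
  [SFinite (volume : Measure E)] {κ φ : E → ℝ} {μ : Measure E} [IsFiniteMeasure μ]

lemma integrable_prod_comp_sub (hκ : Integrable κ) :
    Integrable (uncurry fun x y => κ (x - y)) ((volume : Measure E).prod μ) := by
  simpa [uncurry_def] using
    (integrable_const (1 : ℝ) (μ := μ)).convolution_integrand (ContinuousLinearMap.mul ℝ ℝ) hκ

lemma integrable_mollify (hκ : Integrable κ) : Integrable (mollify κ μ) :=
  (integrable_prod_comp_sub hκ).integral_prod_left

lemma integral_norm_mollify_le (hκ : Integrable κ) :
    ∫ x, ‖mollify κ μ x‖ ≤ μ.real univ * ∫ x, ‖κ x‖ := by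
  have hint := integrable_prod_comp_sub (μ := μ) hκ.norm
  calc ∫ x, ‖mollify κ μ x‖ ≤ ∫ x, ∫ y, ‖κ (x - y)‖ ∂μ :=
        integral_mono (integrable_mollify hκ).norm hint.integral_prod_left
          fun _ => norm_integral_le_integral_norm _
    _ = ∫ y, ∫ x, ‖κ (x - y)‖ ∂volume ∂μ := integral_integral_swap hint
    _ = μ.real univ * ∫ x, ‖κ x‖ := by
        simp only [integral_sub_right_eq_self (fun x => ‖κ x‖), integral_const, smul_eq_mul]

lemma integral_mul_mollify {M : ℝ} (hκ : Integrable κ) (hφ : Measurable φ)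
    (hM : ∀ x, |φ x| ≤ M) : ∫ x, φ x * mollify κ μ x = ∫ y, kernelAvg κ φ y ∂μ := by
  have hint : Integrable (uncurry fun x y => κ (x - y) * φ x) ((volume : Measure E).prod μ) :=
    (integrable_prod_comp_sub hκ).mul_bdd (hφ.comp measurable_fst).aestronglyMeasurable
      (.of_forall fun _ => hM _)
  calc ∫ x, φ x * mollify κ μ x = ∫ x, ∫ y, κ (x - y) * φ x ∂μ := by
        simp only [mollify, integral_mul_const, mul_comm (φ _)]
    _ = ∫ y, ∫ x, κ (x - y) * φ x ∂volume ∂μ := integral_integral_swap hint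
    _ = ∫ y, kernelAvg κ φ y ∂μ := by simp only [kernelAvg_eq_integral_sub]

end Mollify

lemma measurable_mollify {E : Type*} [NormedAddCommGroup E] [MeasurableSpace E] [BorelSpace E]
    [SecondCountableTopology E] {κ : E → ℝ} (hκ : Continuous κ) (μ : Measure E) [SFinite μ] :
    Measurable (mollify κ μ) := by
  have hκ' : StronglyMeasurable (uncurry fun x y => κ (x - y)) :=
    (hκ.comp continuous_sub).stronglyMeasurable
  exact hκ'.integral_prod_right.measurable

lemma hasCompactSupport_mollify_restrict {E : Type*} [NormedAddCommGroup E] [MeasurableSpace E]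
    [ProperSpace E] {κ : E → ℝ} (hκ : HasCompactSupport κ) (μ : Measure E) (R : ℝ) :
    HasCompactSupport (mollify κ (μ.restrict (Metric.closedBall 0 R))) := by
  obtain ⟨r, hr⟩ := hκ.isCompact.isBounded.subset_closedBall 0
  refine HasCompactSupport.intro (isCompact_closedBall (0 : E) (r + R)) fun x hx => ?_
  refine setIntegral_eq_zero_of_forall_eq_zero fun y hy => ?_
  by_contra hne
  have hxy := hr (subset_tsupport _ (mem_support.2 hne))
  rw [mem_closedBall_zero_iff] at hxy hy hx
  refine hx ?_
  calc ‖x‖ = ‖(x - y) + y‖ := by rw [sub_add_cancel]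
    _ ≤ r + R := norm_add_le_of_le hxy hy

namespace IsTestFun

section Mollify

variable {E : Type*} [NormedAddCommGroup E] [NormedSpace ℝ E] [MeasurableSpace E] [BorelSpace E]
  {κ κ' : E → ℝ} {μ : Measure E} [IsFiniteMeasure μ]

lemma integrable_comp_sub_left (hκ : IsTestFun κ) (x : E) : Integrable (fun y => κ (x - y)) μ := by
  obtain ⟨C, hC⟩ := hκ.continuous.bounded_above_of_compact_support hκ.compact
  exact .of_bound (hκ.continuous.measurable.comp (measurable_const_sub x)).aestronglyMeasurable C
    (.of_forall fun _ => hC _)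

lemma mollify_sub (hκ : IsTestFun κ) (hκ' : IsTestFun κ') :
    mollify (κ - κ') μ = mollify κ μ - mollify κ' μ := by
  ext x
  exact integral_sub (hκ.integrable_comp_sub_left x) (hκ'.integrable_comp_sub_left x)

lemma fwdDiff_mollify (hκ : IsTestFun κ) (h : E) :
    fwdDiff h (mollify κ μ) = mollify (fwdDiff h κ) μ := by
  have hsplit : fwdDiff h κ = (fun y => κ (y + h)) - κ := rfl
  rw [hsplit, (hκ.comp_add_right h).mollify_sub hκ]
  ext x
  simp only [fwdDiff, mollify, Pi.sub_apply, sub_add_eq_add_sub]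

lemma fwdDiff_iter_mollify (hκ : IsTestFun κ) (h : E) (n : ℕ) :
    (fwdDiff h)^[n] (mollify κ μ) = mollify ((fwdDiff h)^[n] κ) μ := by
  induction n with
  | zero => rfl
  | succ n ih =>
    rw [iterate_succ_apply', iterate_succ_apply', ih, (hκ.fwdDiff_iter h n).fwdDiff_mollify]

protected lemma mollify_restrict [FiniteDimensional ℝ E] (hκ : IsTestFun κ) (R : ℝ) :
    IsTestFun (mollify κ (μ.restrict (Metric.closedBall 0 R))) := by
  have : ProperSpace E := FiniteDimensional.proper_real E
  have hconv : mollify κ (μ.restrict (Metric.closedBall 0 R)) =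
      (fun _ => (1 : ℝ)) ⋆[ContinuousLinearMap.mul ℝ ℝ, μ.restrict (Metric.closedBall 0 R)] κ := by
    ext x
    simp [mollify, convolution_def]
  refine ⟨?_, hasCompactSupport_mollify_restrict hκ.compact μ R⟩
  rw [hconv]
  exact hκ.compact.contDiff_convolution_right (n := ⊤) _ (locallyIntegrable_const _) hκ.smooth

end Mollify

section Convolution

variable {E : Type*} [NormedAddCommGroup E] [NormedSpace ℝ E] [MeasureSpace E] [BorelSpace E]
  {κ κ₁ κ₂ φ : E → ℝ} {M : ℝ}

protected lemma kernelAvg [FiniteDimensional ℝ E] [(volume : Measure E).IsAddHaarMeasure]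
    (hκ : IsTestFun κ) (hφ : Measurable φ) (hM : ∀ x, |φ x| ≤ M) (hc : HasCompactSupport φ) :
    IsTestFun (kernelAvg κ φ) := by
  have hconv : kernelAvg κ φ = φ ⋆ fun x => κ (-x) := by
    ext y
    rw [kernelAvg_eq_integral_sub, convolution_lsmul]
    simp only [neg_sub, smul_eq_mul, mul_comm]
  have hloc : LocallyIntegrable φ :=
    (locallyIntegrable_const M).mono hφ.aestronglyMeasurable
      (.of_forall fun x => (hM x).trans (le_abs_self M))
  rw [hconv]
  exact ⟨hκ.comp_neg.compact.contDiff_convolution_right (n := ⊤) _ hloc hκ.comp_neg.smooth,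
    hc.convolution _ hκ.comp_neg.compact⟩

variable [IsLocallyFiniteMeasure (volume : Measure E)]

protected lemma convolution (h₁ : IsTestFun κ₁)
    (h₂ : IsTestFun κ₂) : IsTestFun (κ₁ ⋆ κ₂) :=
  ⟨h₂.compact.contDiff_convolution_right (n := ⊤) _ h₁.continuous.locallyIntegrable h₂.smooth,
    h₁.compact.convolution _ h₂.compact⟩

lemma fwdDiff_convolution (h₁ : IsTestFun κ₁) (h₂ : IsTestFun κ₂) (h : E) :
    fwdDiff h (κ₁ ⋆ κ₂) = κ₁ ⋆ fwdDiff h κ₂ := by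
  have hint {κ : E → ℝ} (hκ : IsTestFun κ) (x : E) : Integrable fun t => κ₁ t * κ (x - t) :=
    (h₁.continuous.mul (hκ.continuous.comp (by fun_prop))).integrable_of_hasCompactSupport
      h₁.compact.mul_right
  ext x
  simp only [fwdDiff, convolution_lsmul, smul_eq_mul, mul_sub]
  rw [integral_sub (hint (h₂.comp_add_right h) x) (hint h₂ x)]
  simp only [sub_add_eq_add_sub]

lemma fwdDiff_iter_convolution (h₁ : IsTestFun κ₁) (h₂ : IsTestFun κ₂) (h : E) (n : ℕ) :
    (fwdDiff h)^[n] (κ₁ ⋆ κ₂) = κ₁ ⋆ (fwdDiff h)^[n] κ₂ := by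
  induction n with
  | zero => rfl
  | succ n ih =>
    rw [iterate_succ_apply', iterate_succ_apply', ih,
      h₁.fwdDiff_convolution (h₂.fwdDiff_iter h n)]

end Convolution

end IsTestFun

/-! ### A reproducing kernel of higher order -/

section ReprKernel

lemma sum_neg_one_pow_sub_mul_choose {R : Type*} [CommRing R] (f : ℕ → R) (m : ℕ) :
    ∑ k ∈ Finset.range (m + 1), (-1) ^ (m - k) * (m.choose k : R) * f k =
      (-1) ^ m * (f 0 - ∑ k ∈ Finset.range m, (-1) ^ k * (m.choose (k + 1) : R) * f (k + 1)) := by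
  have hsign {k : ℕ} (hk : k ∈ Finset.range m) :
      (-1 : R) ^ (m - (k + 1)) = -((-1) ^ m * (-1) ^ k) := by
    obtain ⟨l, rfl⟩ := Nat.exists_eq_add_of_le (Finset.mem_range.1 hk)
    have hk' : ((-1 : R)) ^ k * (-1) ^ k = 1 := by rw [← mul_pow]; simp
    rw [Nat.add_sub_cancel_left, pow_add, pow_succ]
    linear_combination (-(-1) ^ l) * hk'
  rw [Finset.sum_range_succ', Finset.sum_congr rfl fun k hk => by rw [hsign hk], mul_sub,
    Finset.mul_sum]
  simp only [neg_mul, Finset.sum_neg_distrib, Nat.sub_zero, Nat.choose_zero_right, Nat.cast_one,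
    mul_one, mul_assoc]
  ring

variable (E : Type*) [NormedAddCommGroup E] [NormedSpace ℝ E] [FiniteDimensional ℝ E]
  [MeasureSpace E]

/-- A smooth probability density supported in the closed unit ball. -/
def bumpKernel : E → ℝ :=
  (⟨1 / 2, 1, by norm_num, by norm_num⟩ : ContDiffBump (0 : E)).normed volume

/-- The combination `∑_{k=1}^m (-1)^(k-1) (m choose k) ρ_k` of the dilates `ρ_k` by `k` of
`bumpKernel`. With it, averaging minus the identity is an average of differences of order `m`. -/
def reprKernel (m : ℕ) : E → ℝ :=
  ∑ k ∈ Finset.range m,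
    ((-1) ^ k * (m.choose (k + 1) : ℝ)) • dilate ((k + 1 : ℕ) : ℝ) (bumpKernel E)

variable {E} {g : E → ℝ} {M ε : ℝ}

lemma bumpKernel_nonneg (x : E) : 0 ≤ bumpKernel E x := ContDiffBump.nonneg_normed _ x

variable [BorelSpace E] [(volume : Measure E).IsAddHaarMeasure]

lemma isTestFun_bumpKernel : IsTestFun (bumpKernel E) :=
  ⟨ContDiffBump.contDiff_normed (n := ⊤) _, ContDiffBump.hasCompactSupport_normed _⟩

lemma integral_bumpKernel : ∫ x, bumpKernel E x = 1 := ContDiffBump.integral_normed _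

lemma bumpKernel_eq_zero {x : E} (hx : 1 < ‖x‖) : bumpKernel E x = 0 := by
  by_contra hne
  have hmem : x ∈ support (bumpKernel E) := hne
  rw [bumpKernel, ContDiffBump.support_normed_eq, mem_ball_zero_iff] at hmem
  exact lt_asymm hx hmem

lemma isTestFun_reprKernel (m : ℕ) : IsTestFun (reprKernel E m) :=
  .sum fun _ _ => (isTestFun_bumpKernel.dilate (by positivity)).const_smul _

lemma kernelAvg_dilate (hε : 0 < ε) (κ φ : E → ℝ) (y : E) :
    kernelAvg (dilate ε κ) φ y = ∫ u, κ u * φ (y + ε • u) :=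
  integral_dilate_mul hε κ fun u => φ (y + u)

lemma kernelAvg_dilate_reprKernel (hg : Measurable g) (hM : ∀ y, |g y| ≤ M) (m : ℕ) (hε : 0 < ε)
    (y : E) : kernelAvg (dilate ε (reprKernel E m)) g y =
      ∑ k ∈ Finset.range m, (-1) ^ k * (m.choose (k + 1) : ℝ) *
        ∫ u, bumpKernel E u * g (y + (k + 1) • ε • u) := by
  have hdil (k : ℕ) : IsTestFun (dilate ε (dilate ((k + 1 : ℕ) : ℝ) (bumpKernel E))) :=
    (isTestFun_bumpKernel.dilate (by positivity)).dilate hε.ne'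
  rw [reprKernel, dilate_sum_smul, kernelAvg_sum_smul (fun k _ => (hdil k).integrable) hg hM]
  refine Finset.sum_congr rfl fun k _ => ?_
  rw [dilate_dilate, kernelAvg_dilate (by positivity)]
  simp only [← Nat.cast_smul_eq_nsmul ℝ, smul_smul, mul_comm ε]

lemma integral_bumpKernel_mul_fwdDiff_iter (hg : Measurable g) (hM : ∀ y, |g y| ≤ M) (m : ℕ)
    (ε : ℝ) (y : E) : ∫ u, bumpKernel E u * (fwdDiff (ε • u))^[m] g y =
      ∑ k ∈ Finset.range (m + 1), (-1) ^ (m - k) * (m.choose k : ℝ) *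
        ∫ u, bumpKernel E u * g (y + k • ε • u) := by
  have hint (k : ℕ) : Integrable fun u => bumpKernel E u * g (y + k • ε • u) :=
    isTestFun_bumpKernel.integrable.mul_bdd
      (hg.comp (by fun_prop)).aestronglyMeasurable (.of_forall fun _ => hM _)
  simp only [← integral_const_mul]
  rw [← integral_finsetSum _ fun k _ => (hint k).const_mul _]
  congr 1 with u
  rw [fwdDiff_iter_eq_sum_shift, Finset.mul_sum]
  refine Finset.sum_congr rfl fun k _ => ?_
  rw [zsmul_eq_mul]
  push_cast
  ring

lemma kernelAvg_dilate_reprKernel_sub (hg : Measurable g) (hM : ∀ y, |g y| ≤ M) (m : ℕ)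
    (hε : 0 < ε) (y : E) : kernelAvg (dilate ε (reprKernel E m)) g y - g y =
      -(-1) ^ m * ∫ u, bumpKernel E u * (fwdDiff (ε • u))^[m] g y := by
  have hzero : ∫ u, bumpKernel E u * g (y + 0 • ε • u) = g y := by
    simp [integral_mul_const, integral_bumpKernel]
  have hsign : ((-1 : ℝ)) ^ m * (-1) ^ m = 1 := by rw [← mul_pow]; simp
  rw [integral_bumpKernel_mul_fwdDiff_iter hg hM, sum_neg_one_pow_sub_mul_choose, hzero,
    ← kernelAvg_dilate_reprKernel hg hM m hε]
  linear_combination (g y - kernelAvg (dilate ε (reprKernel E m)) g y) * hsign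

lemma integral_reprKernel {m : ℕ} (hm : m ≠ 0) : ∫ u, reprKernel E m u = 1 := by
  obtain ⟨k, rfl⟩ := Nat.exists_eq_succ_of_ne_zero hm
  have hdiff (u : E) : (fwdDiff u)^[k + 1] (fun _ : E => (1 : ℝ)) 0 = 0 := by
    rw [iterate_succ_apply, fwdDiff_const]
    simpa using norm_fwdDiff_iter_le (f := fun _ : E => (0 : ℝ)) (C := 0) (by simp) u k 0
  have hrepr := kernelAvg_dilate_reprKernel_sub (g := fun _ : E => 1) (M := 1) measurable_const
    (by simp) (k + 1) one_pos 0
  simp only [hdiff, mul_zero, integral_zero, dilate_one, kernelAvg, mul_one] at hrepr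
  exact sub_eq_zero.1 hrepr

lemma tendsto_kernelAvg_dilate {κ : E → ℝ} (hκ : Integrable κ) (hκ1 : ∫ x, κ x = 1)
    (hg : Continuous g) (hM : ∀ y, |g y| ≤ M) (y : E) :
    Tendsto (fun ε => kernelAvg (dilate ε κ) g y) (𝓝[>] 0) (𝓝 (g y)) := by
  have hlim : ∫ u, κ u * g (y + (0 : ℝ) • u) = g y := by simp [integral_mul_const, hκ1]
  have hcont : Continuous fun ε : ℝ => ∫ u, κ u * g (y + ε • u) :=
    continuous_of_dominated
      (fun ε => hκ.aestronglyMeasurable.mul (hg.comp (by fun_prop)).aestronglyMeasurable)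
      (fun ε => .of_forall fun u => by
        rw [norm_mul]; exact mul_le_mul_of_nonneg_left (hM _) (norm_nonneg _))
      (hκ.norm.mul_const M) (.of_forall fun u => by fun_prop)
  rw [← hlim]
  refine ((hcont.tendsto 0).mono_left nhdsWithin_le_nhds).congr' ?_
  filter_upwards [self_mem_nhdsWithin] with ε hε
  exact (kernelAvg_dilate hε κ g y).symm

end ReprKernel

section DoubleKernel

variable {E : Type*} [NormedAddCommGroup E] [NormedSpace ℝ E] [FiniteDimensional ℝ E]
  [MeasureSpace E] [BorelSpace E] [(volume : Measure E).IsAddHaarMeasure]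

lemma convolution_lsmul_comm (κ₁ κ₂ : E → ℝ) : κ₁ ⋆ κ₂ = κ₂ ⋆ κ₁ := by
  rw [← convolution_flip]
  congr 1
  ext
  simp

variable (E) in
/-- The product `Ψ ⋆ Ψ_{1/2}` of two scales of the kernel `Ψ = reprKernel E m`, so that the dilates
of this kernel at two consecutive dyadic scales share a factor. -/
def doubleKernel (m : ℕ) : E → ℝ :=
  reprKernel E m ⋆ dilate 2⁻¹ (reprKernel E m)

lemma isTestFun_doubleKernel (m : ℕ) : IsTestFun (doubleKernel E m) :=
  (isTestFun_reprKernel m).convolution ((isTestFun_reprKernel m).dilate (by norm_num))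

lemma integral_doubleKernel {m : ℕ} (hm : m ≠ 0) : ∫ x, doubleKernel E m x = 1 := by
  have hΨ := isTestFun_reprKernel (E := E) m
  rw [doubleKernel, integral_convolution _ hΨ.integrable (hΨ.dilate (by norm_num)).integrable,
    integral_dilate (by norm_num), integral_reprKernel hm]
  simp

lemma dilate_doubleKernel (m : ℕ) {ε : ℝ} (hε : 0 < ε) : dilate ε (doubleKernel E m) =
    dilate ε (reprKernel E m) ⋆ dilate (ε / 2) (reprKernel E m) := by
  rw [doubleKernel, dilate_convolution hε, dilate_dilate, div_eq_mul_inv]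

lemma dilate_half_doubleKernel (m : ℕ) {ε : ℝ} (hε : 0 < ε) : dilate (ε / 2) (doubleKernel E m) =
    dilate (ε / 4) (reprKernel E m) ⋆ dilate (ε / 2) (reprKernel E m) := by
  rw [dilate_doubleKernel m (half_pos hε), convolution_lsmul_comm, div_div]
  norm_num

end DoubleKernel

lemma integral_norm_le_of_forall_integral_mul_le {E : Type*} [NormedAddCommGroup E] [ProperSpace E]
    [MeasurableSpace E] [BorelSpace E] {ν : Measure E} {F : E → ℝ} {B : ℝ} (hF : Measurable F)
    (hFi : Integrable F ν)
    (hB : ∀ φ : E → ℝ, Measurable φ → (∀ x, |φ x| ≤ 1) → HasCompactSupport φ →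
      ∫ x, φ x * F x ∂ν ≤ B) : ∫ x, ‖F x‖ ∂ν ≤ B := by
  set σ : E → ℝ := fun x => if 0 ≤ F x then 1 else -1 with hσ
  have hσ_meas : Measurable σ :=
    .ite (measurableSet_le measurable_const hF) measurable_const measurable_const
  have hσ_le (x : E) : |σ x| ≤ 1 := by simp only [hσ]; split_ifs <;> simp
  have hσ_mul (x : E) : σ x * F x = ‖F x‖ := by
    simp only [hσ, Real.norm_eq_abs]
    split_ifs with hx
    · rw [one_mul, abs_of_nonneg hx]
    · rw [neg_one_mul, abs_of_neg (not_le.1 hx)]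
  refine le_of_tendsto' ((aecover_closedBall (x := (0 : E))
    tendsto_natCast_atTop_atTop).integral_tendsto_of_countably_generated hFi.norm) fun R => ?_
  have hball : MeasurableSet (Metric.closedBall (0 : E) R) :=
    Metric.isClosed_closedBall.measurableSet
  calc ∫ x in Metric.closedBall 0 R, ‖F x‖ ∂ν
      = ∫ x, (Metric.closedBall 0 R).indicator σ x * F x ∂ν := by
        rw [← integral_indicator hball]
        simp only [← hσ_mul, indicator_mul_left]
    _ ≤ B := hB _ (hσ_meas.indicator hball)
        (fun x => (norm_indicator_le_norm_self σ x).trans (hσ_le x))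
        (.intro (isCompact_closedBall (0 : E) R) fun x hx => indicator_of_notMem hx _)

/-! ### Measures with a smoothing bound -/

section HasSmoothingBound

variable {E : Type*} [NormedAddCommGroup E]

/-- `M` bounds both `|g|` and the `α`-Hölder seminorm of `g`. -/
structure IsHolderBounded (α M : ℝ) (g : E → ℝ) : Prop where
  abs_le : ∀ y, |g y| ≤ M
  abs_fwdDiff_le : ∀ k y, |fwdDiff k g y| ≤ M * ‖k‖ ^ α

lemma IsHolderBounded.nonneg {α M : ℝ} {g : E → ℝ} (hg : IsHolderBounded α M g) : 0 ≤ M :=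
  (abs_nonneg _).trans (hg.abs_le 0)

variable [NormedSpace ℝ E] [MeasurableSpace E]

/-- Differences of order `m` of `α`-Hölder test functions have `μ`-integrals of order `‖h‖ ^ s`,
with constant `K`. For `m ≥ 1` every finite measure has this with `s = α`; a larger `s` encodes
regularity of `μ`. -/
def HasSmoothingBound (μ : Measure E) (m : ℕ) (α s K : ℝ) : Prop :=
  ∀ (g : E → ℝ) (M : ℝ), IsTestFun g → IsHolderBounded α M g → ∀ h, ‖h‖ ≤ 1 →
    |∫ y, (fwdDiff h)^[m] g y ∂μ| ≤ K * ‖h‖ ^ s * M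

end HasSmoothingBound

section Increment

variable {E : Type*} [NormedAddCommGroup E] [NormedSpace ℝ E] [FiniteDimensional ℝ E]
  [MeasureSpace E] [BorelSpace E] [(volume : Measure E).IsAddHaarMeasure]
  {μ : Measure E} [IsFiniteMeasure μ] {g φ : E → ℝ} {m n : ℕ} {α s r K M ε : ℝ}

lemma integral_kernelAvg_dilate_reprKernel_sub (hg : Continuous g) (hM : ∀ y, |g y| ≤ M) (m : ℕ)
    (hε : 0 < ε) : ∫ y, (kernelAvg (dilate ε (reprKernel E m)) g y - g y) ∂μ =
      -(-1) ^ m * ∫ u, bumpKernel E u * ∫ y, (fwdDiff (ε • u))^[m] g y ∂μ := by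
  have hcont : Continuous fun p : E × E => (fwdDiff (ε • p.2))^[m] g p.1 := by
    simp only [fwdDiff_iter_eq_sum_shift, zsmul_eq_mul]
    fun_prop
  have hint : Integrable (uncurry fun y u => bumpKernel E u * (fwdDiff (ε • u))^[m] g y)
      (μ.prod volume) :=
    (isTestFun_bumpKernel.integrable.comp_snd μ).mul_bdd hcont.aestronglyMeasurable
      (.of_forall fun p => norm_fwdDiff_iter_le hM _ m _)
  simp only [kernelAvg_dilate_reprKernel_sub hg.measurable hM m hε, integral_const_mul]
  rw [integral_integral_swap hint]
  simp only [integral_const_mul]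

lemma HasSmoothingBound.abs_integral_kernelAvg_sub_le (hμ : HasSmoothingBound μ m α s K)
    (hs : 0 ≤ s) (hK : 0 ≤ K) (hg : IsTestFun g) (hgM : IsHolderBounded α M g) (hε : 0 < ε)
    (hε1 : ε ≤ 1) :
    |∫ y, (kernelAvg (dilate ε (reprKernel E m)) g y - g y) ∂μ| ≤ K * ε ^ s * M := by
  have hM : 0 ≤ M := hgM.nonneg
  rw [integral_kernelAvg_dilate_reprKernel_sub hg.continuous hgM.abs_le m hε, abs_mul, abs_neg,
    abs_pow, abs_neg, abs_one, one_pow, one_mul, ← Real.norm_eq_abs]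
  suffices hu : ∀ u, ‖bumpKernel E u * ∫ y, (fwdDiff (ε • u))^[m] g y ∂μ‖ ≤
      bumpKernel E u * (K * ε ^ s * M) by
    refine (norm_integral_le_of_norm_le (isTestFun_bumpKernel.integrable.mul_const _)
      (.of_forall hu)).trans_eq ?_
    rw [integral_mul_const, integral_bumpKernel, one_mul]
  intro u
  rw [norm_mul, Real.norm_of_nonneg (bumpKernel_nonneg u)]
  rcases le_or_gt ‖u‖ 1 with hu | hu
  · refine mul_le_mul_of_nonneg_left ?_ (bumpKernel_nonneg u)
    have hεu : ‖ε • u‖ ≤ ε := by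
      rw [norm_smul, Real.norm_of_nonneg hε.le]
      exact mul_le_of_le_one_right hε.le hu
    refine (hμ g M hg hgM _ (hεu.trans hε1)).trans ?_
    gcongr
  · simp [bumpKernel_eq_zero hu]

lemma HasSmoothingBound.integral_kernelAvg_sub_kernelAvg_le (hμ : HasSmoothingBound μ m α s K)
    (hs : 0 ≤ s) (hK : 0 ≤ K) (hg : IsTestFun g) (hgM : IsHolderBounded α M g) {δ : ℝ}
    (hδ : 0 < δ) (hδε : δ ≤ ε) (hε1 : ε ≤ 1) :
    ∫ y, (kernelAvg (dilate δ (reprKernel E m)) g y -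
      kernelAvg (dilate ε (reprKernel E m)) g y) ∂μ ≤ 2 * (K * ε ^ s * M) := by
  have hε : 0 < ε := hδ.trans_le hδε
  have hM : 0 ≤ M := hgM.nonneg
  have hsub_integrable {η : ℝ} (hη : 0 < η) :
      Integrable (fun y => kernelAvg (dilate η (reprKernel E m)) g y - g y) μ :=
    ((((isTestFun_reprKernel m).dilate hη.ne').kernelAvg hg.continuous.measurable hgM.abs_le
      hg.compact).sub hg).integrable
  have hδ_le : |∫ y, (kernelAvg (dilate δ (reprKernel E m)) g y - g y) ∂μ| ≤ K * ε ^ s * M :=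
    (hμ.abs_integral_kernelAvg_sub_le hs hK hg hgM hδ (hδε.trans hε1)).trans (by gcongr)
  have hε_le := hμ.abs_integral_kernelAvg_sub_le hs hK hg hgM hε hε1
  have hsplit := integral_sub (hsub_integrable hδ) (hsub_integrable hε)
  simp only [sub_sub_sub_cancel_right] at hsplit
  rw [hsplit]
  linarith [(abs_le.1 hδ_le).2, (abs_le.1 hε_le).1]

lemma IsTestFun.exists_isHolderBounded_kernelAvg_fwdDiff_iter_dilate {κ : E → ℝ} (hκ : IsTestFun κ)
    (hr : 0 ≤ r) (hrn : r ≤ n) (hα : 0 ≤ α) (hα1 : α ≤ 1) :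
    ∃ C, 0 ≤ C ∧ ∀ ε, 0 < ε → ε ≤ 1 → ∀ h, ∀ φ : E → ℝ, Measurable φ → (∀ x, |φ x| ≤ 1) →
      IsHolderBounded α (C * ε ^ (-α - r) * ‖h‖ ^ r)
        (kernelAvg ((fwdDiff h)^[n] (dilate ε κ)) φ) := by
  obtain ⟨C₀, hC₀, hC₀n⟩ := hκ.exists_integral_norm_fwdDiff_iter_dilate_le hr hrn
  obtain ⟨C₁, hC₁, hC₁n⟩ := hκ.exists_integral_norm_fwdDiff_fwdDiff_iter_dilate_le hr hrn hα hα1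
  refine ⟨C₀ + C₁, by positivity, fun ε hε hε1 h φ hφ hφ1 => ?_⟩
  have hκε := (hκ.dilate hε.ne').fwdDiff_iter h n
  have hexp : ε ^ (-α - r) * ‖h‖ ^ r = (‖h‖ / ε) ^ r / ε ^ α := by
    rw [Real.div_rpow (norm_nonneg h) hε.le, Real.rpow_sub hε, Real.rpow_neg hε.le]
    field_simp
  rw [mul_assoc, hexp]
  refine ⟨fun y => ?_, fun k y => ?_⟩
  · refine (abs_kernelAvg_le hκε.integrable hφ hφ1 y).trans ?_
    rw [one_mul]
    have hεα : ε ^ α ≤ 1 := Real.rpow_le_one hε.le hε1 hα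
    calc _ ≤ C₀ * (‖h‖ / ε) ^ r := hC₀n ε hε h
      _ ≤ (C₀ + C₁) * ((‖h‖ / ε) ^ r / ε ^ α) := by
        gcongr
        · exact le_add_of_nonneg_right hC₁
        · exact le_div_self (by positivity) (by positivity) hεα
  · rw [fwdDiff_kernelAvg hκε.integrable hφ hφ1]
    refine (abs_kernelAvg_le (hκε.fwdDiff (-k)).integrable hφ hφ1 y).trans ?_
    rw [one_mul]
    calc _ ≤ C₁ * (‖-k‖ / ε) ^ α * (‖h‖ / ε) ^ r := hC₁n ε hε h (-k)
      _ = C₁ * ((‖h‖ / ε) ^ r / ε ^ α) * ‖k‖ ^ α := by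
        rw [norm_neg, Real.div_rpow (norm_nonneg k) hε.le]; ring
      _ ≤ (C₀ + C₁) * ((‖h‖ / ε) ^ r / ε ^ α) * ‖k‖ ^ α := by
        gcongr
        exact le_add_of_nonneg_left hC₀

lemma fwdDiff_iter_mollify_sub_mollify_doubleKernel (μ : Measure E) [IsFiniteMeasure μ] (m n : ℕ)
    (hε : 0 < ε) (h : E) : (fwdDiff h)^[n]
      (mollify (dilate (ε / 2) (doubleKernel E m)) μ - mollify (dilate ε (doubleKernel E m)) μ) =
    mollify (dilate (ε / 4) (reprKernel E m) ⋆ (fwdDiff h)^[n] (dilate (ε / 2) (reprKernel E m)) -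
      dilate ε (reprKernel E m) ⋆ (fwdDiff h)^[n] (dilate (ε / 2) (reprKernel E m))) μ := by
  have hΨ {η : ℝ} (hη : 0 < η) : IsTestFun (dilate η (reprKernel E m)) :=
    (isTestFun_reprKernel m).dilate hη.ne'
  have hε2 : 0 < ε / 2 := by positivity
  have hε4 : 0 < ε / 4 := by positivity
  rw [dilate_half_doubleKernel m hε, dilate_doubleKernel m hε,
    ← ((hΨ hε4).convolution (hΨ hε2)).mollify_sub ((hΨ hε).convolution (hΨ hε2)),
    (((hΨ hε4).convolution (hΨ hε2)).sub ((hΨ hε).convolution (hΨ hε2))).fwdDiff_iter_mollify,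
    fwdDiff_iter_sub, (hΨ hε4).fwdDiff_iter_convolution (hΨ hε2),
    (hΨ hε).fwdDiff_iter_convolution (hΨ hε2)]

variable (E) in
lemma exists_integral_norm_fwdDiff_iter_mollify_doubleKernel_le (m : ℕ) (hr : 0 ≤ r) (hrn : r ≤ n)
    (hα : 0 ≤ α) (hα1 : α ≤ 1) (hs : 0 ≤ s) : ∃ C, 0 ≤ C ∧
      ∀ (μ : Measure E) [IsFiniteMeasure μ] (K : ℝ), 0 ≤ K → HasSmoothingBound μ m α s K →
      ∀ ε, 0 < ε → ε ≤ 1 → ∀ h, ∫ x, ‖(fwdDiff h)^[n] (mollify (dilate (ε / 2) (doubleKernel E m)) μ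
        - mollify (dilate ε (doubleKernel E m)) μ) x‖ ≤ C * K * ε ^ (s - α - r) * ‖h‖ ^ r := by
  have hΨ := isTestFun_reprKernel (E := E) m
  obtain ⟨C, hC, hCε⟩ := hΨ.exists_isHolderBounded_kernelAvg_fwdDiff_iter_dilate hr hrn hα hα1
  refine ⟨2 * C * 2⁻¹ ^ (-α - r), by positivity, fun μ _ K hK hμ ε hε hε1 h => ?_⟩
  have hε2 : 0 < ε / 2 := by positivity
  have hε4 : 0 < ε / 4 := by positivity
  have hΨ_diff := (hΨ.dilate hε2.ne').fwdDiff_iter h n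
  have hconv {η : ℝ} (hη : 0 < η) := (hΨ.dilate hη.ne').convolution hΨ_diff
  have hκ := (hconv hε4).sub (hconv hε)
  rw [fwdDiff_iter_mollify_sub_mollify_doubleKernel μ m n hε]
  refine integral_norm_le_of_forall_integral_mul_le (measurable_mollify hκ.continuous μ)
    (integrable_mollify hκ.integrable) fun φ hφ hφ1 hφc => ?_
  rw [integral_mul_mollify hκ.integrable hφ hφ1,
    kernelAvg_sub_left (hconv hε4).integrable (hconv hε).integrable hφ hφ1,
    kernelAvg_convolution (hΨ.dilate hε4.ne').integrable hΨ_diff.integrable hφ hφ1,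
    kernelAvg_convolution (hΨ.dilate hε.ne').integrable hΨ_diff.integrable hφ hφ1]
  refine (hμ.integral_kernelAvg_sub_kernelAvg_le hs hK (hΨ_diff.kernelAvg hφ hφ1 hφc)
    (hCε (ε / 2) hε2 (by linarith) h φ hφ hφ1) hε4 (by linarith) hε1).trans_eq ?_
  have hexp : s - α - r = s + (-α - r) := by ring
  rw [hexp, Real.rpow_add hε, div_eq_mul_inv, Real.mul_rpow hε.le (by norm_num)]
  ring

end Increment

section GeometricL1

variable {X F : Type*} [MeasurableSpace X] {ν : Measure X} [NormedAddCommGroup F]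
  {f : ℕ → X → F} {g : X → F} {A q : ℝ}

lemma dist_toL1_eq_integral_norm {f g : X → F} (hf : Integrable f ν) (hg : Integrable g ν) :
    dist (hf.toL1 f) (hg.toL1 g) = ∫ x, ‖(f - g) x‖ ∂ν := by
  rw [dist_eq_norm, ← Integrable.toL1_sub, L1.norm_of_fun_eq_integral_norm]

lemma exists_tendsto_integral_norm_sub_of_le_geometric [CompleteSpace F]
    (hf : ∀ j, Integrable (f j) ν) (hq : q < 1)
    (h : ∀ j, ∫ x, ‖(f (j + 1) - f j) x‖ ∂ν ≤ A * q ^ j) :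
    ∃ g : X → F, Integrable g ν ∧ Tendsto (fun j => ∫ x, ‖(f j - g) x‖ ∂ν) atTop (𝓝 0) := by
  have hcauchy : CauchySeq fun j => (hf j).toL1 (f j) := by
    refine cauchySeq_of_le_geometric q A hq fun j => ?_
    rw [dist_comm, dist_toL1_eq_integral_norm]
    exact h j
  obtain ⟨G, hG⟩ := cauchySeq_tendsto_of_complete hcauchy
  refine ⟨G, L1.integrable_coeFn G, (tendsto_iff_dist_tendsto_zero.1 hG).congr fun j => ?_⟩
  rw [← dist_toL1_eq_integral_norm (hf j) (L1.integrable_coeFn G), Integrable.toL1_coeFn]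

lemma integral_norm_sub_le_of_le_geometric (hf : ∀ j, Integrable (f j) ν) (hg : Integrable g ν)
    (hq : q < 1) (h : ∀ j, ∫ x, ‖(f (j + 1) - f j) x‖ ∂ν ≤ A * q ^ j)
    (hlim : Tendsto (fun j => ∫ x, ‖(f j - g) x‖ ∂ν) atTop (𝓝 0)) (j : ℕ) :
    ∫ x, ‖(g - f j) x‖ ∂ν ≤ A * q ^ j / (1 - q) := by
  have hlim' : Tendsto (fun j => (hf j).toL1 (f j)) atTop (𝓝 (hg.toL1 g)) := by
    rw [tendsto_iff_dist_tendsto_zero]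
    exact hlim.congr fun j => (dist_toL1_eq_integral_norm _ _).symm
  rw [← dist_toL1_eq_integral_norm hg (hf j), dist_comm]
  refine dist_le_of_le_geometric_of_tendsto q A hq (fun j => ?_) hlim' j
  rw [dist_comm, dist_toL1_eq_integral_norm]
  exact h j

end GeometricL1

/-! ### Besov norms -/

section Besov

variable {d : ℕ} {f g : Euc d → ℝ} {s : ℝ} {p : ℝ≥0∞}

lemma besovNorm_zero (s : ℝ) (p : ℝ≥0∞) : besovNorm s p (0 : Euc d → ℝ) = 0 := by
  have hzero (h : Euc d) (n : ℕ) : (fwdDiff h)^[n] (0 : Euc d → ℝ) = 0 := by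
    simpa using fwdDiff_iter_sub h (0 : Euc d → ℝ) 0 n
  simp only [besovNorm, besovSeminorm, hzero, eLpNorm_zero, ENNReal.zero_div, ENNReal.iSup_zero,
    add_zero]

lemma besovNorm_congr_ae (hfg : f =ᵐ[volume] g) (s : ℝ) (p : ℝ≥0∞) :
    besovNorm s p f = besovNorm s p g := by
  simp only [besovNorm, besovSeminorm, eLpNorm_congr_ae hfg,
    eLpNorm_congr_ae (ae_eq_fwdDiff_iter hfg _ _)]

lemma besovNorm_add_le (hf : AEStronglyMeasurable f) (hg : AEStronglyMeasurable g) (s : ℝ)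
    (hp : 1 ≤ p) : besovNorm s p (f + g) ≤ besovNorm s p f + besovNorm s p g := by
  have hsemi : besovSeminorm s p (f + g) ≤ besovSeminorm s p f + besovSeminorm s p g := by
    refine iSup₂_le fun h hh => ?_
    rw [fwdDiff_iter_add]
    refine (ENNReal.div_le_div_right (eLpNorm_add_le (aestronglyMeasurable_fwdDiff_iter hf h _)
      (aestronglyMeasurable_fwdDiff_iter hg h _) hp) _).trans ?_
    rw [ENNReal.add_div]
    exact add_le_add (le_iSup₂_of_le h hh le_rfl) (le_iSup₂_of_le h hh le_rfl)
  exact (add_le_add (eLpNorm_add_le hf hg hp) hsemi).trans_eq (add_add_add_comm _ _ _ _)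

lemma eLpNorm_one_eq_ofReal_integral_norm {X : Type*} [MeasurableSpace X] {ν : Measure X}
    {F : Type*} [NormedAddCommGroup F] {f : X → F} (hf : Integrable f ν) :
    eLpNorm f 1 ν = ENNReal.ofReal (∫ x, ‖f x‖ ∂ν) := by
  rw [eLpNorm_one_eq_lintegral_enorm, ofReal_integral_norm_eq_lintegral_enorm hf]

lemma besovNorm_one_le (hf : Integrable f) {A B : ℝ} (hB0 : 0 ≤ B) (hA : ∫ x, ‖f x‖ ≤ A)
    (hB : ∀ h, ∫ x, ‖(fwdDiff h)^[⌊s⌋₊ + 1] f x‖ ≤ B * ‖h‖ ^ s) :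
    besovNorm s 1 f ≤ ENNReal.ofReal (A + B) := by
  have hA0 : 0 ≤ A := (integral_nonneg fun _ => norm_nonneg _).trans hA
  rw [ENNReal.ofReal_add hA0 hB0]
  refine add_le_add ?_ (iSup₂_le fun h hh => ?_)
  · rw [eLpNorm_one_eq_ofReal_integral_norm hf]
    exact ENNReal.ofReal_le_ofReal hA
  · rw [eLpNorm_one_eq_ofReal_integral_norm (integrable_fwdDiff_iter hf h _)]
    refine ENNReal.div_le_of_le_mul ?_
    rw [← ENNReal.ofReal_mul hB0]
    exact ENNReal.ofReal_le_ofReal (hB h)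

lemma toReal_besovNorm_top_le {α M : ℝ} (hα : α < 1) (hg : IsHolderBounded α M g) :
    (besovNorm α ⊤ g).toReal ≤ 2 * M := by
  have hM : 0 ≤ M := hg.nonneg
  refine ENNReal.toReal_le_of_le_ofReal (by positivity) ?_
  rw [two_mul, ENNReal.ofReal_add hM hM]
  refine add_le_add ?_ (iSup₂_le fun k _ => ?_)
  · rw [eLpNorm_exponent_top]
    exact eLpNormEssSup_le_of_ae_bound (.of_forall hg.abs_le)
  · rw [Nat.floor_eq_zero.2 hα, zero_add, iterate_one, eLpNorm_exponent_top]
    refine ENNReal.div_le_of_le_mul ?_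
    rw [← ENNReal.ofReal_mul hM]
    exact eLpNormEssSup_le_of_ae_bound (.of_forall (hg.abs_fwdDiff_le k))

lemma memBesov_of_tendsto {ι : Type*} {l : Filter ι} [l.NeBot] {f : ι → Euc d → ℝ} (hp : 1 ≤ p)
    (hf : ∀ i, MemBesov s p (f i)) (hfm : ∀ i, AEStronglyMeasurable (f i))
    (hg : AEStronglyMeasurable g) (hlim : Tendsto (fun i => besovNorm s p (g - f i)) l (𝓝 0)) :
    MemBesov s p g := by
  intro η hη
  have hη2 : 0 < η / 2 := ENNReal.half_pos hη.ne'
  obtain ⟨i, hi⟩ := (hlim.eventually_lt_const hη2).exists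
  obtain ⟨ψ, hψ⟩ := hf i (η / 2) hη2
  refine ⟨ψ, ?_⟩
  have hsplit : (fun y => g y - ψ y) = (g - f i) + fun y => f i y - ψ y := by
    ext y
    simp
  rw [hsplit]
  refine (besovNorm_add_le (hg.sub (hfm i))
    ((hfm i).sub ψ.continuous.aestronglyMeasurable) s hp).trans_lt ?_
  exact (ENNReal.add_lt_add hi hψ).trans_eq (ENNReal.add_halves η)

lemma exists_besovNorm_sub_le_of_le_geometric {f : ℕ → Euc d → ℝ} {A B q : ℝ}
    (hf : ∀ j, Integrable (f j)) (hq : 0 ≤ q) (hq1 : q < 1) (hB0 : 0 ≤ B)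
    (hA : ∀ j, ∫ x, ‖(f (j + 1) - f j) x‖ ≤ A * q ^ j)
    (hB : ∀ j h, ∫ x, ‖(fwdDiff h)^[⌊s⌋₊ + 1] (f (j + 1) - f j) x‖ ≤ B * ‖h‖ ^ s * q ^ j) :
    ∃ g : Euc d → ℝ, Integrable g ∧ Tendsto (fun j => ∫ x, ‖(f j - g) x‖) atTop (𝓝 0) ∧
      ∀ j, besovNorm s 1 (g - f j) ≤ ENNReal.ofReal ((A + B) * q ^ j / (1 - q)) := by
  obtain ⟨g, hg, hlim⟩ := exists_tendsto_integral_norm_sub_of_le_geometric hf hq1 hA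
  have hlim_diff (h : Euc d) : Tendsto (fun j => ∫ x, ‖((fwdDiff h)^[⌊s⌋₊ + 1] (f j) -
      (fwdDiff h)^[⌊s⌋₊ + 1] g) x‖) atTop (𝓝 0) := by
    refine squeeze_zero (fun j => integral_nonneg fun _ => norm_nonneg _) (fun j => ?_)
      (by simpa using hlim.const_mul (2 ^ (⌊s⌋₊ + 1)))
    rw [← fwdDiff_iter_sub]
    exact integral_norm_fwdDiff_iter_le ((hf j).sub hg) h _
  have hdist_diff (j : ℕ) (h : Euc d) :
      ∫ x, ‖(fwdDiff h)^[⌊s⌋₊ + 1] (g - f j) x‖ ≤ B * ‖h‖ ^ s * q ^ j / (1 - q) := by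
    rw [fwdDiff_iter_sub]
    refine integral_norm_sub_le_of_le_geometric (fun j => integrable_fwdDiff_iter (hf j) h _)
      (integrable_fwdDiff_iter hg h _) hq1 (fun j => ?_) (hlim_diff h) j
    rw [← fwdDiff_iter_sub]
    exact hB j h
  refine ⟨g, hg, hlim, fun j => ?_⟩
  have : 0 < 1 - q := sub_pos.2 hq1
  refine (besovNorm_one_le (hg.sub (hf j)) (B := B * q ^ j / (1 - q)) (by positivity)
    (integral_norm_sub_le_of_le_geometric hf hg hq1 hA hlim j) fun h => ?_).trans_eq ?_
  · exact (hdist_diff j h).trans_eq (by ring)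
  · congr 1
    ring

namespace IsTestFun

variable {κ : Euc d → ℝ}

lemma memBesov (hκ : IsTestFun κ) (s : ℝ) (p : ℝ≥0∞) : MemBesov s p κ := by
  refine fun η hη => ⟨hκ.compact.toSchwartzMap hκ.smooth, ?_⟩
  have hzero : (fun y => κ y - hκ.compact.toSchwartzMap hκ.smooth y) = 0 := by
    ext y
    simp
  rwa [hzero, besovNorm_zero]

lemma memZygmund (hκ : IsTestFun κ) (α : ℝ) : MemZygmund α κ := ⟨hκ.continuous, hκ.memBesov α ⊤⟩

lemma exists_besovNorm_mollify_le (hκ : IsTestFun κ) (hs : 0 ≤ s) :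
    ∃ C, 0 ≤ C ∧ ∀ (μ : Measure (Euc d)) [IsFiniteMeasure μ],
      besovNorm s 1 (mollify κ μ) ≤ ENNReal.ofReal (μ.real univ * C) := by
  obtain ⟨C, hC, hCh⟩ := hκ.exists_integral_norm_fwdDiff_iter_le (ν := volume) (⌊s⌋₊ + 1)
  refine ⟨(∫ x, ‖κ x‖) + C, by positivity, fun μ _ => ?_⟩
  rw [mul_add]
  refine besovNorm_one_le (integrable_mollify hκ.integrable) (by positivity)
    (integral_norm_mollify_le hκ.integrable) fun h => ?_
  rw [hκ.fwdDiff_iter_mollify, mul_assoc]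
  refine (integral_norm_mollify_le (hκ.fwdDiff_iter h _).integrable).trans ?_
  gcongr
  refine (hCh h).trans (mul_le_mul_of_nonneg_left (min_one_pow_le_rpow (norm_nonneg _) hs ?_) hC)
  exact_mod_cast (Nat.lt_floor_add_one s).le

lemma memBesov_mollify (hκ : IsTestFun κ) (hs : 0 ≤ s) (μ : Measure (Euc d)) [IsFiniteMeasure μ] :
    MemBesov s 1 (mollify κ μ) := by
  have hball (R : ℝ) : MeasurableSet (Metric.closedBall (0 : Euc d) R) :=
    Metric.isClosed_closedBall.measurableSet
  have hsub (R : ℝ) : mollify κ μ - mollify κ (μ.restrict (Metric.closedBall 0 R)) =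
      mollify κ (μ.restrict (Metric.closedBall 0 R)ᶜ) := by
    ext x
    exact sub_eq_of_eq_add' (integral_add_compl (hball R) (hκ.integrable_comp_sub_left x)).symm
  have htight : Tendsto (fun R => μ (Metric.closedBall 0 R)ᶜ) atTop (𝓝 0) := by
    simpa using tendsto_measure_compl_closedBall_of_isTightMeasureSet
      (isTightMeasureSet_singleton (μ := μ)) 0
  obtain ⟨C, -, hCμ⟩ := hκ.exists_besovNorm_mollify_le hs
  refine memBesov_of_tendsto (l := atTop) le_rfl
    (fun R => (hκ.mollify_restrict (μ := μ) R).memBesov s 1)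
    (fun R => (hκ.mollify_restrict R).continuous.aestronglyMeasurable)
    (integrable_mollify hκ.integrable).aestronglyMeasurable ?_
  refine tendsto_of_tendsto_of_tendsto_of_le_of_le tendsto_const_nhds ?_ (fun _ => zero_le)
    fun R => (congrArg (besovNorm s 1) (hsub R)).trans_le (hCμ _)
  have hreal := ((ENNReal.tendsto_toReal ENNReal.zero_ne_top).comp htight).mul_const C
  simpa [Measure.real] using ENNReal.tendsto_ofReal hreal

end IsTestFun

end Besov

/-! ### From smoothing bounds to densities -/

section WithDensity

variable {X : Type*} [MeasurableSpace X] {μ ν : Measure X} {f : X → ℝ}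

lemma tendsto_integral_mul_of_tendsto_integral_norm_sub {ι : Type*} {l : Filter ι}
    {f : ι → X → ℝ} {g φ : X → ℝ} {M : ℝ} (hφ : AEStronglyMeasurable φ ν) (hM : ∀ x, |φ x| ≤ M)
    (hf : ∀ i, Integrable (f i) ν) (hg : Integrable g ν)
    (hlim : Tendsto (fun i => ∫ x, ‖(f i - g) x‖ ∂ν) l (𝓝 0)) :
    Tendsto (fun i => ∫ x, φ x * f i x ∂ν) l (𝓝 (∫ x, φ x * g x ∂ν)) := by
  have hφ_mul {u : X → ℝ} (hu : Integrable u ν) : Integrable (fun x => φ x * u x) ν :=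
    hu.bdd_mul hφ (.of_forall hM)
  rw [tendsto_iff_norm_sub_tendsto_zero]
  refine squeeze_zero (fun _ => norm_nonneg _) (fun i => ?_) (by simpa using hlim.const_mul M)
  rw [← integral_sub (hφ_mul (hf i)) (hφ_mul hg), ← integral_const_mul]
  refine norm_integral_le_of_norm_le (((hf i).sub hg).norm.const_mul M) (.of_forall fun x => ?_)
  rw [← mul_sub, norm_mul]
  exact mul_le_mul_of_nonneg_right (hM x) (norm_nonneg _)

variable [TopologicalSpace X] [HasOuterApproxClosed X] [BorelSpace X] [IsFiniteMeasure μ]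

lemma add_withDensity_ofReal_neg_of_integral_eq (hf : Integrable f ν)
    (h : ∀ φ : BoundedContinuousFunction X ℝ, ∫ x, φ x * f x ∂ν = ∫ x, φ x ∂μ) :
    μ + ν.withDensity (fun x => ENNReal.ofReal (-f x)) =
      ν.withDensity fun x => ENNReal.ofReal (f x) := by
  have hpos := isFiniteMeasure_withDensity_ofReal hf.2
  have hneg : IsFiniteMeasure (ν.withDensity fun x => ENNReal.ofReal (-f x)) :=
    isFiniteMeasure_withDensity_ofReal hf.neg.2
  have hint {u : X → ℝ} (hu : Integrable u ν) (φ : BoundedContinuousFunction X ℝ) :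
      ∫ x, φ x ∂(ν.withDensity fun x => ENNReal.ofReal (u x)) = ∫ x, max (u x) 0 * φ x ∂ν := by
    rw [integral_withDensity_eq_integral_toReal_smul₀ hu.1.aemeasurable.ennreal_ofReal
      (.of_forall fun x => ENNReal.ofReal_lt_top)]
    rfl
  have hφ_mul {u : X → ℝ} (hu : Integrable u ν) (φ : BoundedContinuousFunction X ℝ) :
      Integrable (fun x => max (u x) 0 * φ x) ν :=
    hu.pos_part.mul_bdd φ.continuous.aestronglyMeasurable
      (.of_forall fun x => φ.norm_coe_le_norm x)
  have hf_neg : Integrable (fun x => -f x) ν := hf.neg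
  refine ext_of_forall_integral_eq_of_IsFiniteMeasure fun φ => ?_
  rw [integral_add_measure (φ.integrable μ) (φ.integrable _), hint hf, hint hf_neg, ← h φ,
    ← eq_sub_iff_add_eq, ← integral_sub (hφ_mul hf φ) (hφ_mul hf_neg φ)]
  congr 1 with x
  have hparts : max (f x) 0 - max (-f x) 0 = f x := max_zero_sub_max_neg_zero_eq_self (f x)
  rw [← sub_mul, hparts, mul_comm]

lemma ae_nonneg_of_integral_eq [SigmaFinite ν] (hf : Integrable f ν)
    (h : ∀ φ : BoundedContinuousFunction X ℝ, ∫ x, φ x * f x ∂ν = ∫ x, φ x ∂μ) :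
    0 ≤ᵐ[ν] f := by
  have hle : (fun x => ENNReal.ofReal (-f x)) ≤ᵐ[ν] fun x => ENNReal.ofReal (f x) := by
    refine ae_le_of_forall_setLIntegral_le_of_sigmaFinite₀ hf.neg.1.aemeasurable.ennreal_ofReal
      fun s hs _ => ?_
    rw [← withDensity_apply _ hs, ← withDensity_apply _ hs,
      ← add_withDensity_ofReal_neg_of_integral_eq hf h, Measure.add_apply]
    exact le_add_self
  filter_upwards [hle] with x hx
  by_contra hlt
  have hneg : f x < 0 := not_le.1 hlt
  rw [ENNReal.ofReal_of_nonpos hneg.le, nonpos_iff_eq_zero, ENNReal.ofReal_eq_zero] at hx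
  linarith

lemma eq_withDensity_ofReal_of_integral_eq [SigmaFinite ν] (hf : Integrable f ν)
    (h : ∀ φ : BoundedContinuousFunction X ℝ, ∫ x, φ x * f x ∂ν = ∫ x, φ x ∂μ) :
    μ = ν.withDensity fun x => ENNReal.ofReal (f x) := by
  have hneg : (fun x => ENNReal.ofReal (-f x)) =ᵐ[ν] 0 := by
    filter_upwards [ae_nonneg_of_integral_eq hf h] with x hx
    simpa using hx
  simpa [withDensity_congr_ae hneg] using add_withDensity_ofReal_neg_of_integral_eq hf h

end WithDensity

section DyadicMollify

variable {E : Type*} [NormedAddCommGroup E] [NormedSpace ℝ E] [FiniteDimensional ℝ E]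
  [MeasureSpace E] [BorelSpace E] [(volume : Measure E).IsAddHaarMeasure]

lemma tendsto_integral_mul_mollify_dilate {κ φ : E → ℝ} {M : ℝ} (hκ : IsTestFun κ)
    (hκ1 : ∫ x, κ x = 1) (hφ : Continuous φ) (hM : ∀ x, |φ x| ≤ M) (μ : Measure E)
    [IsFiniteMeasure μ] :
    Tendsto (fun ε => ∫ x, φ x * mollify (dilate ε κ) μ x) (𝓝[>] 0) (𝓝 (∫ x, φ x ∂μ)) := by
  have hκε {ε : ℝ} (hε : 0 < ε) : IsTestFun (dilate ε κ) := hκ.dilate hε.ne'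
  suffices hlim : Tendsto (fun ε => ∫ y, kernelAvg (dilate ε κ) φ y ∂μ) (𝓝[>] 0)
      (𝓝 (∫ x, φ x ∂μ)) by
    refine hlim.congr' ?_
    filter_upwards [self_mem_nhdsWithin] with ε hε
    exact (integral_mul_mollify (hκε hε).integrable hφ.measurable hM).symm
  refine tendsto_integral_filter_of_dominated_convergence (fun _ => M * ∫ x, ‖κ x‖) ?_ ?_
    (integrable_const _)
    (.of_forall fun y => tendsto_kernelAvg_dilate hκ.integrable hκ1 hφ hM y)
  · filter_upwards [self_mem_nhdsWithin] with ε hε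
    have hcont : Continuous (uncurry fun y u => dilate ε κ u * φ (y + u)) :=
      ((hκε hε).continuous.comp continuous_snd).mul (hφ.comp continuous_add)
    exact hcont.stronglyMeasurable.integral_prod_right.aestronglyMeasurable
  · filter_upwards [self_mem_nhdsWithin] with ε hε
    refine .of_forall fun y => ?_
    rw [← integral_norm_dilate hε κ]
    exact abs_kernelAvg_le (hκε hε).integrable hφ.measurable hM y

/-- The mollification of `μ` at scale `2⁻ʲ` by `doubleKernel E m`. -/
def dyadicMollify (m : ℕ) (μ : Measure E) (j : ℕ) : E → ℝ :=
  mollify (dilate (2⁻¹ ^ j) (doubleKernel E m)) μ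

lemma isTestFun_dilate_doubleKernel (m j : ℕ) :
    IsTestFun (dilate (2⁻¹ ^ j) (doubleKernel E m)) :=
  (isTestFun_doubleKernel m).dilate (by positivity)

lemma integrable_dyadicMollify (m : ℕ) (μ : Measure E) [IsFiniteMeasure μ] (j : ℕ) :
    Integrable (dyadicMollify m μ j) :=
  integrable_mollify (isTestFun_dilate_doubleKernel m j).integrable

lemma tendsto_integral_mul_dyadicMollify {m : ℕ} (hm : m ≠ 0) {φ : E → ℝ} {M : ℝ}
    (hφ : Continuous φ) (hM : ∀ x, |φ x| ≤ M) (μ : Measure E) [IsFiniteMeasure μ] :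
    Tendsto (fun j => ∫ x, φ x * dyadicMollify m μ j x) atTop (𝓝 (∫ x, φ x ∂μ)) := by
  have hscale : Tendsto (fun j : ℕ => (2⁻¹ : ℝ) ^ j) atTop (𝓝[>] 0) :=
    tendsto_nhdsWithin_iff.2 ⟨tendsto_pow_atTop_nhds_zero_of_lt_one (by norm_num) (by norm_num),
      .of_forall fun j => mem_Ioi.2 (by positivity)⟩
  exact (tendsto_integral_mul_mollify_dilate (isTestFun_doubleKernel m)
    (integral_doubleKernel hm) hφ hM μ).comp hscale

variable (E) in
lemma exists_integral_norm_fwdDiff_iter_dyadicMollify_le (m : ℕ) {n : ℕ} {r α s : ℝ} (hr : 0 ≤ r)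
    (hrn : r ≤ n) (hα : 0 ≤ α) (hα1 : α ≤ 1) (hs : 0 ≤ s) : ∃ C, 0 ≤ C ∧
      ∀ (μ : Measure E) [IsFiniteMeasure μ] (K : ℝ), 0 ≤ K → HasSmoothingBound μ m α s K →
      ∀ j h, ∫ x, ‖(fwdDiff h)^[n] (dyadicMollify m μ (j + 1) - dyadicMollify m μ j) x‖ ≤
        C * K * ‖h‖ ^ r * (2⁻¹ ^ (s - α - r)) ^ j := by
  obtain ⟨C, hC, hCε⟩ :=
    exists_integral_norm_fwdDiff_iter_mollify_doubleKernel_le E m hr hrn hα hα1 hs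
  refine ⟨C, hC, fun μ _ K hK hμ j h => ?_⟩
  have hincr := hCε μ K hK hμ (2⁻¹ ^ j) (by positivity)
    (pow_le_one₀ (by norm_num) (by norm_num)) h
  rw [div_eq_mul_inv, ← pow_succ] at hincr
  have hpow : ((2⁻¹ : ℝ) ^ j) ^ (s - α - r) = (2⁻¹ ^ (s - α - r)) ^ j := by
    rw [← Real.rpow_natCast_mul (by norm_num), mul_comm, Real.rpow_mul_natCast (by norm_num)]
  exact hincr.trans_eq (by rw [hpow]; ring)

end DyadicMollify

section Density

variable {d m : ℕ} {α s a : ℝ}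

lemma exists_tendsto_dyadicMollify_besovNorm_sub_le (d m : ℕ) (hα : 0 ≤ α) (hα1 : α ≤ 1)
    (ha : 0 ≤ a) (has : α + a < s) : ∃ C q, 0 ≤ C ∧ 0 ≤ q ∧ q < 1 ∧
      ∀ (μ : Measure (Euc d)) [IsFiniteMeasure μ] (K : ℝ), 0 ≤ K → HasSmoothingBound μ m α s K →
      ∃ f : Euc d → ℝ, Integrable f ∧
        Tendsto (fun j => ∫ x, ‖(dyadicMollify m μ j - f) x‖) atTop (𝓝 0) ∧
        ∀ j, besovNorm a 1 (f - dyadicMollify m μ j) ≤ ENNReal.ofReal (C * K * q ^ j) := by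
  have hs : 0 ≤ s := by linarith
  have hfloor : a ≤ (⌊a⌋₊ + 1 : ℕ) := by exact_mod_cast (Nat.lt_floor_add_one a).le
  obtain ⟨C₀, hC₀, hincr₀⟩ := exists_integral_norm_fwdDiff_iter_dyadicMollify_le (Euc d) m
    (n := 0) le_rfl Nat.cast_zero.ge hα hα1 hs
  obtain ⟨C₁, hC₁, hincr₁⟩ := exists_integral_norm_fwdDiff_iter_dyadicMollify_le (Euc d) m
    ha hfloor hα hα1 hs
  set q : ℝ := 2⁻¹ ^ (s - α - a)
  have hq0 : 0 ≤ q := by positivity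
  have hq1 : q < 1 := Real.rpow_lt_one (by norm_num) (by norm_num) (by linarith)
  have : 0 < 1 - q := sub_pos.2 hq1
  refine ⟨(C₀ + C₁) / (1 - q), q, by positivity, hq0, hq1, fun μ _ K hK hμ => ?_⟩
  have hincr₀' (j : ℕ) : ∫ x, ‖(dyadicMollify m μ (j + 1) - dyadicMollify m μ j) x‖ ≤
      C₀ * K * q ^ j := by
    have hincr := hincr₀ μ K hK hμ j 0
    rw [iterate_zero_apply, Real.rpow_zero, mul_one, sub_zero] at hincr
    refine hincr.trans (mul_le_mul_of_nonneg_left (pow_le_pow_left₀ (by positivity) ?_ j)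
      (by positivity))
    exact Real.rpow_le_rpow_of_exponent_ge (by norm_num) (by norm_num) (by linarith)
  obtain ⟨f, hf, hlim, hbound⟩ := exists_besovNorm_sub_le_of_le_geometric (s := a)
    (integrable_dyadicMollify m μ) hq0 hq1 (by positivity) hincr₀'
    fun j h => hincr₁ μ K hK hμ j h
  exact ⟨f, hf, hlim, fun j => (hbound j).trans_eq (congrArg ENNReal.ofReal (by ring))⟩

lemma memBesov_of_besovNorm_sub_dyadicMollify_le {μ : Measure (Euc d)} [IsFiniteMeasure μ]
    {f : Euc d → ℝ} {B q : ℝ} (ha : 0 ≤ a) (hf : Integrable f) (hq : 0 ≤ q) (hq1 : q < 1)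
    (h : ∀ j, besovNorm a 1 (f - dyadicMollify m μ j) ≤ ENNReal.ofReal (B * q ^ j)) :
    MemBesov a 1 f := by
  refine memBesov_of_tendsto (l := atTop) le_rfl
    (fun j => (isTestFun_dilate_doubleKernel m j).memBesov_mollify ha μ)
    (fun j => (integrable_dyadicMollify m μ j).aestronglyMeasurable) hf.aestronglyMeasurable ?_
  refine tendsto_of_tendsto_of_tendsto_of_le_of_le tendsto_const_nhds ?_ (fun _ => zero_le) h
  simpa using ENNReal.tendsto_ofReal
    ((tendsto_pow_atTop_nhds_zero_of_lt_one hq hq1).const_mul B)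

theorem exists_density_of_hasSmoothingBound (d : ℕ) (hm : m ≠ 0) (hα : 0 ≤ α) (hα1 : α ≤ 1)
    (ha : 0 ≤ a) (has : α + a < s) : ∃ C, 0 ≤ C ∧
      ∀ (μ : Measure (Euc d)) [IsFiniteMeasure μ] (K : ℝ), 0 ≤ K → HasSmoothingBound μ m α s K →
      ∃ f : Euc d → ℝ, Integrable f ∧ 0 ≤ᵐ[volume] f ∧
        μ = volume.withDensity (fun x => ENNReal.ofReal (f x)) ∧
        MemBesov a 1 f ∧ besovNorm a 1 f ≤ ENNReal.ofReal (C * (μ.real univ + K)) := by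
  obtain ⟨C₀, hC₀, hmollify⟩ :=
    (isTestFun_dilate_doubleKernel (E := Euc d) m 0).exists_besovNorm_mollify_le ha
  obtain ⟨C₁, q, hC₁, hq0, hq1, hlimit⟩ :=
    exists_tendsto_dyadicMollify_besovNorm_sub_le d m hα hα1 ha has
  refine ⟨C₀ + C₁, by positivity, fun μ _ K hK hμ => ?_⟩
  obtain ⟨f, hf, hlim, hbound⟩ := hlimit μ K hK hμ
  have hweak (φ : BoundedContinuousFunction (Euc d) ℝ) : ∫ x, φ x * f x = ∫ x, φ x ∂μ :=
    tendsto_nhds_unique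
      (tendsto_integral_mul_of_tendsto_integral_norm_sub φ.continuous.aestronglyMeasurable
        φ.norm_coe_le_norm (integrable_dyadicMollify m μ) hf hlim)
      (tendsto_integral_mul_dyadicMollify hm φ.continuous φ.norm_coe_le_norm μ)
  refine ⟨f, hf, ae_nonneg_of_integral_eq hf hweak, eq_withDensity_ofReal_of_integral_eq hf hweak,
    memBesov_of_besovNorm_sub_dyadicMollify_le ha hf hq0 hq1 hbound, ?_⟩
  calc besovNorm a 1 f
      = besovNorm a 1 ((f - dyadicMollify m μ 0) + dyadicMollify m μ 0) := by
        rw [sub_add_cancel]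
    _ ≤ ENNReal.ofReal (C₁ * K * q ^ 0) + ENNReal.ofReal (μ.real univ * C₀) :=
        (besovNorm_add_le (hf.sub (integrable_dyadicMollify m μ 0)).aestronglyMeasurable
          (integrable_dyadicMollify m μ 0).aestronglyMeasurable a le_rfl).trans
          (add_le_add (hbound 0) (hmollify μ))
    _ ≤ ENNReal.ofReal ((C₀ + C₁) * (μ.real univ + K)) := by
        rw [← ENNReal.ofReal_add (by positivity) (by positivity), pow_zero]
        refine ENNReal.ofReal_le_ofReal ?_
        have : 0 ≤ C₀ * K + C₁ * μ.real univ := by positivity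
        linarith

end Density

/-! ### Smoothing bounds from two-scale estimates -/

section TwoScale

variable {θ γ e A T : ℝ} {m : ℕ}

lemma rpow_rpow_add_div_rpow_pow_le {r : ℝ} (hr : 0 < r) (hr1 : r ≤ 1) (hθ : θ ≠ 0)
    (hme : γ * θ * e ≤ m * (1 - γ)) :
    (r ^ (γ * θ)) ^ e + (r / (r ^ (γ * θ)) ^ (1 / θ)) ^ m ≤ 2 * r ^ (γ * θ * e) := by
  have hscale : (r ^ (γ * θ)) ^ (1 / θ) = r ^ γ := by
    rw [← Real.rpow_mul hr.le, mul_one_div, mul_div_cancel_right₀ _ hθ]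
  have hratio : r / r ^ γ = r ^ (1 - γ) := by rw [Real.rpow_sub hr, Real.rpow_one]
  have hpow : r ^ ((1 - γ) * m) ≤ r ^ (γ * θ * e) :=
    Real.rpow_le_rpow_of_exponent_ge hr hr1 (by linarith)
  rw [hscale, hratio, ← Real.rpow_mul hr.le, ← Real.rpow_mul_natCast hr.le]
  linarith

lemma exists_holder_exponent {a₀ θ a δ : ℝ} (ha₀ : 0 < a₀) (hθ : 0 < θ) (ha : 0 ≤ a)
    (haa₀ : a < a₀) (hδ : 0 < δ) : ∃ α γ : ℝ, 0 < α ∧ α < 1 ∧ γ < 1 ∧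
      α + a < γ * θ * (α / θ * (1 + a₀)) ∧ α / θ ≤ a / (θ * a₀) + δ ∧
      α / θ * (1 + a₀) ≤ (1 + a₀) / (θ * a₀) * a + δ := by
  obtain ⟨α, hα_gt, hα_lt⟩ : ∃ α, a / a₀ < α ∧ α < min 1 (a / a₀ + δ * θ / (1 + a₀)) :=
    exists_between (lt_min ((div_lt_one ha₀).2 haa₀) (lt_add_of_pos_right _ (by positivity)))
  have hα : 0 < α := lt_of_le_of_lt (by positivity) hα_gt
  have haα : a < α * a₀ := (div_lt_iff₀ ha₀).1 hα_gt
  obtain ⟨γ, hγ_gt, hγ1⟩ : ∃ γ, (α + a) / (α * (1 + a₀)) < γ ∧ γ < 1 :=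
    exists_between ((div_lt_one (by positivity)).2 (by linarith))
  have hαδ : α / θ ≤ a / (θ * a₀) + δ / (1 + a₀) :=
    calc α / θ ≤ (a / a₀ + δ * θ / (1 + a₀)) / θ := by
          gcongr
          exact (hα_lt.trans_le (min_le_right _ _)).le
      _ = a / (θ * a₀) + δ / (1 + a₀) := by field_simp
  refine ⟨α, γ, hα, hα_lt.trans_le (min_le_left _ _), hγ1, ?_, ?_, ?_⟩
  · calc α + a < γ * (α * (1 + a₀)) := (div_lt_iff₀ (by positivity)).1 hγ_gt
      _ = γ * θ * (α / θ * (1 + a₀)) := by field_simp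
  · exact hαδ.trans (by gcongr; exact div_le_self hδ.le (by linarith))
  · calc α / θ * (1 + a₀) ≤ (a / (θ * a₀) + δ / (1 + a₀)) * (1 + a₀) := by gcongr
      _ = (1 + a₀) / (θ * a₀) * a + δ := by field_simp

lemma one_add_mul_rpow_mul_rpow_le {K T D A κ κ' τ τ' : ℝ} (hK : 1 ≤ K) (hT : 0 < T)
    (hT1 : T ≤ 1) (hD : 0 ≤ D) (hA : 0 ≤ A) (hκ0 : 0 ≤ κ) (hκ : κ ≤ κ') (hτ0 : 0 ≤ τ)
    (hτ : τ ≤ τ') :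
    1 + (4 * K ^ κ + A) * (D * T ^ (-τ)) ≤ (1 + (4 + A) * D) * (K ^ κ' * T ^ (-τ')) := by
  have hK_one : 1 ≤ K ^ κ' := Real.one_le_rpow hK (hκ0.trans hκ)
  have hK_le : K ^ κ ≤ K ^ κ' := Real.rpow_le_rpow_of_exponent_le hK hκ
  have hT_le : T ^ (-τ) ≤ T ^ (-τ') := Real.rpow_le_rpow_of_exponent_ge hT hT1 (by linarith)
  have hT_one : 1 ≤ T ^ (-τ') :=
    Real.one_le_rpow_of_pos_of_le_one_of_nonpos hT hT1 (by linarith)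
  calc 1 + (4 * K ^ κ + A) * (D * T ^ (-τ))
      ≤ 1 * 1 + (4 * K ^ κ' + A * K ^ κ') * (D * T ^ (-τ')) := by
        rw [one_mul]
        gcongr
        exact le_mul_of_one_le_right hA hK_one
    _ ≤ K ^ κ' * T ^ (-τ') + (4 * K ^ κ' + A * K ^ κ') * (D * T ^ (-τ')) := by gcongr
    _ = (1 + (4 + A) * D) * (K ^ κ' * T ^ (-τ')) := by ring

variable {E : Type*} [NormedAddCommGroup E] [NormedSpace ℝ E] [MeasurableSpace E]
  {μ : Measure E} {α : ℝ}

lemma HasSmoothingBound.of_forall_integral_le {s K : ℝ}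
    (H : ∀ (g : E → ℝ) (M : ℝ), IsTestFun g → IsHolderBounded α M g → ∀ h, ‖h‖ ≤ 1 →
      ∫ y, (fwdDiff h)^[m] g y ∂μ ≤ K * ‖h‖ ^ s * M) : HasSmoothingBound μ m α s K := by
  intro g M hg hgM h hh
  refine abs_le'.2 ⟨H g M hg hgM h hh, ?_⟩
  have hneg : IsHolderBounded α M ((-1 : ℝ) • g) :=
    ⟨fun y => by simpa using hgM.abs_le y, fun k y => by
      rw [fwdDiff_const_smul]
      simpa using hgM.abs_fwdDiff_le k y⟩
  have hle := H _ M (hg.const_smul (-1)) hneg h hh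
  rw [fwdDiff_iter_const_smul] at hle
  simpa [integral_neg] using hle

-- The estimate at the scale `ε = ‖h‖ ^ (γ * θ)` balances the two terms; when this scale is not
-- available, the trivial bound by `2 ^ m` suffices.
theorem hasSmoothingBound_of_two_scale [IsFiniteMeasure μ] (hm : m ≠ 0) (hθ : θ ≠ 0) (he : 0 ≤ e)
    (hme : γ * θ * e ≤ m * (1 - γ)) (hA : 0 ≤ A) (hT : 0 < T) (hT1 : T ≤ 1)
    (H : ∀ ε, 0 < ε → ε ≤ T → ∀ (g : E → ℝ) (M : ℝ), IsTestFun g → IsHolderBounded α M g →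
      ∀ h, ‖h‖ ≤ 1 →
        ∫ y, (fwdDiff h)^[m] g y ∂μ ≤ A * (ε ^ e + (‖h‖ / ε ^ (1 / θ)) ^ m) * M) :
    HasSmoothingBound μ m α (γ * θ * e) ((2 * A + 2 ^ m * μ.real univ) * T ^ (-e)) := by
  refine .of_forall_integral_le fun g M hg hgM h hh => ?_
  have hM : 0 ≤ M := hgM.nonneg
  obtain rfl | hh0 := eq_or_ne h 0
  · have hzero : (fwdDiff (0 : E))^[m] g = 0 := by
      obtain ⟨n, rfl⟩ := Nat.exists_eq_succ_of_ne_zero hm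
      ext y
      simp [iterate_succ_apply', fwdDiff]
    simp only [hzero, Pi.zero_apply, integral_zero]
    positivity
  have hr : 0 < ‖h‖ := norm_pos_iff.2 hh0
  obtain hsmall | hlarge := le_or_gt (‖h‖ ^ (γ * θ)) T
  · have hT_le : 1 ≤ T ^ (-e) :=
      Real.one_le_rpow_of_pos_of_le_one_of_nonpos hT hT1 (neg_nonpos.2 he)
    calc ∫ y, (fwdDiff h)^[m] g y ∂μ
        ≤ A * (2 * ‖h‖ ^ (γ * θ * e)) * M :=
          (H _ (by positivity) hsmall g M hg hgM h hh).trans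
            (by gcongr; exact rpow_rpow_add_div_rpow_pow_le hr hh hθ hme)
      _ = (2 * A + 0) * 1 * ‖h‖ ^ (γ * θ * e) * M := by ring
      _ ≤ (2 * A + 2 ^ m * μ.real univ) * T ^ (-e) * ‖h‖ ^ (γ * θ * e) * M := by
          gcongr
          positivity
  · have hT_le : 1 ≤ T ^ (-e) * ‖h‖ ^ (γ * θ * e) := by
      rw [Real.rpow_neg hT.le, inv_mul_eq_div, one_le_div (by positivity), Real.rpow_mul hr.le]
      exact Real.rpow_le_rpow hT.le hlarge.le he
    calc ∫ y, (fwdDiff h)^[m] g y ∂μ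
        ≤ 2 ^ m * M * μ.real univ :=
          (Real.le_norm_self _).trans (norm_integral_le_of_norm_le_const
            (.of_forall (norm_fwdDiff_iter_le hgM.abs_le h m)))
      _ = (0 + 2 ^ m * μ.real univ) * 1 * M := by ring
      _ ≤ (2 * A + 2 ^ m * μ.real univ) * (T ^ (-e) * ‖h‖ ^ (γ * θ * e)) * M := by
          gcongr
          positivity
      _ = (2 * A + 2 ^ m * μ.real univ) * T ^ (-e) * ‖h‖ ^ (γ * θ * e) * M := by ring

end TwoScale

/-! ### Densities of random variables -/

section RandomVariable

variable {Ω : Type*} {mΩ : MeasurableSpace Ω} {P : Measure Ω} {d : ℕ} {X : Ω → Euc d}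

lemma MemBesov.congr_ae {s : ℝ} {p : ℝ≥0∞} {f g : Euc d → ℝ} (hf : MemBesov s p f)
    (hfg : f =ᵐ[volume] g) : MemBesov s p g := by
  intro η hη
  obtain ⟨φ, hφ⟩ := hf η hη
  exact ⟨φ, (besovNorm_congr_ae (hfg.symm.sub .rfl) s p).trans_lt hφ⟩

lemma hasPDF_and_pdf_toReal_ae_eq [IsFiniteMeasure P] {E : Type*} [MeasurableSpace E]
    {ν : Measure E} {Y : Ω → E} {f : E → ℝ} (hY : AEMeasurable Y P) (hf : AEMeasurable f ν)
    (hf0 : 0 ≤ᵐ[ν] f) (h : P.map Y = ν.withDensity fun y => ENNReal.ofReal (f y)) :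
    HasPDF Y P ν ∧ (fun y => (pdf Y P ν y).toReal) =ᵐ[ν] f := by
  have hpdf := hasPDF_of_map_eq_withDensity hY _ hf.ennreal_ofReal h
  refine ⟨hpdf, ?_⟩
  filter_upwards [(pdf.eq_of_map_eq_withDensity _ hf.ennreal_ofReal).1 h, hf0] with y hy hy0
  rw [hy, ENNReal.toReal_ofReal hy0]

lemma hasSmoothingBound_map_of_two_scale [IsProbabilityMeasure P] {α θ γ e A t : ℝ} {m : ℕ}
    (hX : AEMeasurable X P) (hm : m ≠ 0) (hθ : θ ≠ 0) (he : 0 ≤ e)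
    (hme : γ * θ * e ≤ m * (1 - γ)) (hα1 : α < 1) (hA : 0 ≤ A) (ht : 0 < t)
    (H : ∀ ε, 0 < ε → ε < 1 → ε ≤ t / 2 → ∀ φ : Euc d → ℝ, IsTestFun φ → ∀ h, ‖h‖ ≤ 1 →
      ∫ ω, (fwdDiff h)^[m] φ (X ω) ∂P ≤
        A * (ε ^ e + (‖h‖ / ε ^ (1 / θ)) ^ m) * (besovNorm α ⊤ φ).toReal) :
    HasSmoothingBound (P.map X) m α (γ * θ * e)
      ((4 * A + 2 ^ m) * (2 ^ e * min 1 t ^ (-e))) := by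
  have hT : 0 < min 1 t := lt_min one_pos ht
  have : IsProbabilityMeasure (P.map X) := Measure.isProbabilityMeasure_map hX
  have hbound := hasSmoothingBound_of_two_scale (μ := P.map X) (α := α) (A := 2 * A)
    (T := min 1 t / 2) hm hθ he hme (by positivity) (by positivity)
    (by linarith [min_le_left 1 t]) fun ε hε hεT g M hg hgM h hh => by
      rw [integral_map hX (continuous_fwdDiff_iter hg.continuous h m).aestronglyMeasurable]
      calc ∫ ω, (fwdDiff h)^[m] g (X ω) ∂P
          ≤ A * (ε ^ e + (‖h‖ / ε ^ (1 / θ)) ^ m) * (besovNorm α ⊤ g).toReal :=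
            H ε hε (by linarith [min_le_left 1 t]) (by linarith [min_le_right 1 t]) g hg h hh
        _ ≤ A * (ε ^ e + (‖h‖ / ε ^ (1 / θ)) ^ m) * (2 * M) := by
            gcongr
            exact toReal_besovNorm_top_le hα1 hgM
        _ = 2 * A * (ε ^ e + (‖h‖ / ε ^ (1 / θ)) ^ m) * M := by ring
  have hconst : (2 * (2 * A) + 2 ^ m * (P.map X).real univ) * (min 1 t / 2) ^ (-e) =
      (4 * A + 2 ^ m) * (2 ^ e * min 1 t ^ (-e)) := by
    rw [probReal_univ, Real.div_rpow hT.le zero_le_two, Real.rpow_neg zero_le_two, div_inv_eq_mul]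
    ring
  rwa [hconst] at hbound

end RandomVariable

end

theorem propositionp_general (d : ℕ) (a₀ θ a δ : ℝ) (ha₀ : 0 < a₀) (hθ : 0 < θ)
    (ha : 0 < a) (haa₀ : a < a₀) (hδ : 0 < δ) :
    ∃ α : ℝ, 0 < α ∧ α < 1 ∧ ∃ m₀ : ℕ, ∀ m : ℕ, m₀ ≤ m → ∃ c : ℝ, 0 < c ∧
      ∀ (Ω : Type*) [MeasurableSpace Ω] (P : Measure Ω) [IsProbabilityMeasure P] (X : Ω → Euc d),
        AEMeasurable X P →
      ∀ t K₀ : ℝ, 0 < t → 1 ≤ K₀ →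
        (∀ ε : ℝ, 0 < ε → ε < 1 → ε ≤ t / 2 →
          ∀ φ : Euc d → ℝ, IsTestFun φ →
          ∀ h : Euc d, ‖h‖ ≤ 1 →
            ∫ ω, ((fwdDiff h)^[m] φ) (X ω) ∂P ≤
              K₀ ^ (α / θ) * (ε ^ (α / θ * (1 + a₀)) + (‖h‖ / ε ^ (1 / θ)) ^ m) *
                (besovNorm α ⊤ φ).toReal) →
        HasPDF X P volume ∧
        MemBesov a 1 (fun y => (pdf X P volume y).toReal) ∧
        besovNorm a 1 (fun y => (pdf X P volume y).toReal) ≤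
          ENNReal.ofReal (c * K₀ ^ (a / (θ * a₀) + δ) *
            (min 1 t) ^ (-((1 + a₀) / (θ * a₀) * a) - δ)) := by
  obtain ⟨α, γ, hα, hα1, hγ1, hs, hκ, hτ⟩ := exists_holder_exponent ha₀ hθ ha.le haa₀ hδ
  set e : ℝ := α / θ * (1 + a₀)
  have he : 0 ≤ e := by positivity
  refine ⟨α, hα, hα1, ⌈γ * θ * e / (1 - γ)⌉₊ + 1, fun m hm => ?_⟩
  have hm0 : m ≠ 0 := by lia
  have hme : γ * θ * e ≤ m * (1 - γ) :=
    (div_le_iff₀ (sub_pos.2 hγ1)).1 (Nat.le_of_ceil_le (by lia))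
  obtain ⟨C, hC, hdens⟩ := exists_density_of_hasSmoothingBound d hm0 hα.le hα1.le ha.le hs
  refine ⟨(C + 1) * (1 + (4 + 2 ^ m) * 2 ^ e), by positivity,
    fun Ω _ P _ X hX t K₀ ht hK₀ H => ?_⟩
  have hT : 0 < min 1 t := lt_min one_pos ht
  have hXP : IsProbabilityMeasure (P.map X) := Measure.isProbabilityMeasure_map hX
  obtain ⟨f, hf, hf0, hμ, hfB, hfN⟩ := hdens (P.map X) _ (by positivity)
    (hasSmoothingBound_map_of_two_scale hX hm0 hθ.ne' he hme hα1 (by positivity) ht H)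
  obtain ⟨hpdf, hae⟩ := hasPDF_and_pdf_toReal_ae_eq hX hf.aemeasurable hf0 hμ
  refine ⟨hpdf, hfB.congr_ae hae.symm, (besovNorm_congr_ae hae a 1).trans_le (hfN.trans ?_)⟩
  rw [probReal_univ, ← neg_add', mul_assoc, mul_assoc]
  gcongr
  · exact le_add_of_nonneg_right zero_le_one
  · exact one_add_mul_rpow_mul_rpow_le hK₀ hT (min_le_left _ _) (by positivity) (by positivity)
      (by positivity) hκ he hτ

theorem propositionp (d : ℕ) (a₀ θ a δ : ℝ) (ha₀ : 0 < a₀) (hθ : 0 < θ)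
    (ha : 0 < a) (haa₀ : a < a₀) (hδ : 0 < δ) :
    ∃ m₀ : ℕ, ∀ m : ℕ, m₀ ≤ m → ∃ c : ℝ, 0 < c ∧
      ∀ (d' : ℕ) (β : ℝ) (b : Euc d → Euc d) (σ : Euc d → Matrix (Fin d) (Fin d') ℝ),
        0 < β → β < 1 → MemLp b ⊤ volume → IsBoundedHolder β σ →
      ∀ (Ω : Type*) (mΩ : MeasurableSpace Ω) (P : Measure Ω) (_ : IsProbabilityMeasure P)
        (ℱ : Filtration ℝ≥0 mΩ) (B : ℝ≥0 → Ω → Euc d') (X : ℝ≥0 → Ω → Euc d) (x : Euc d),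
        IsSDESolution b σ x ℱ P B X →
      ∀ (t : ℝ≥0) (K₀ : ℝ), 0 < t → 1 ≤ K₀ →
        (∀ ε : ℝ, 0 < ε → ε < 1 → ε ≤ (t : ℝ) / 2 →
          ∀ α : ℝ, 0 < α → α < 1 →
          ∀ φ : Euc d → ℝ, MemZygmund α φ →
          ∀ h : Euc d, ‖h‖ ≤ 1 →
            ∫ ω, ((fwdDiff h)^[m] φ) (X t ω) ∂P ≤
              K₀ ^ (α / θ) * (ε ^ (α / θ * (1 + a₀)) + (‖h‖ / ε ^ (1 / θ)) ^ m) *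
                (besovNorm α ⊤ φ).toReal) →
        HasPDF (X t) P volume ∧
        MemBesov a 1 (fun y => (pdf (X t) P volume y).toReal) ∧
        besovNorm a 1 (fun y => (pdf (X t) P volume y).toReal) ≤
          ENNReal.ofReal (c * K₀ ^ (a / (θ * a₀) + δ) *
            (min 1 (t : ℝ)) ^ (-((1 + a₀) / (θ * a₀) * a) - δ)) := by
  obtain ⟨α, hα, hα1, m₀, hm₀⟩ := propositionp_general d a₀ θ a δ ha₀ hθ ha haa₀ hδ
  refine ⟨m₀, fun m hm => (hm₀ m hm).imp fun c ⟨hc, hdens⟩ => ⟨hc, ?_⟩⟩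
  intro d' β b σ _ _ _ _ Ω mΩ P _ ℱ B X x hX t K₀ ht hK₀ H
  exact hdens Ω P (X t) ((hX.adapted t).mono (ℱ.le t) le_rfl).aemeasurable t K₀ ht hK₀
    fun ε hε hε1 hεt φ hφ => H ε hε hε1 hεt α hα hα1 φ (hφ.memZygmund α)
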